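/- Let $(M,\partial M)$ be a compact triangulated $n$-manifold, $n\ge 0$, possibly with (possibly empty) boundary $\partial M$, in the broad sense of mod 2 homology manifolds: $M$ is a finite simplicial complex, $\partial M$ is a subcomplex, and for every $k$-simplex $\sigma$ of $M$ the link of $\sigma$ has the $\mathbb Z/2$-homology of the sphere $S^{n-k-1}$ if $\sigma\notin\partial M$ (with $S^{-1}=\emptyset$), and the $\mathbb Z/2$-homology of a point if $\sigma\in\partial M$. A vertex ordering of $M$ is a partial order on the vertices that is total on the vertices of each simplex. Given a vertex ordering, let $C^k(M,\partial M;\mathbb Z/2)$ and $Z^k(M,\partial M;\mathbb Z/2)$ be the normalized relative simplicial cochains and cocycles (both are $0$ for $k<0$), let $d$ be the coboundary, let $\cup_i$ be Steenrod's cochain products defined with the vertex ordering ($\cup_i=0$ for $i<0$), and let $\int_{[M,\partial M]}w\in\mathbb Z/2$ be the sum of the values of the $n$-cochain $w$ on all $n$-simplices of $M$. A quadratic function on $M$, with the given vertex ordering, is a function $Q\colon Z^{n-1}(M,\partial M;\mathbb Z/2)\to\mathbb R/\mathbb Z$ such that $$Q(p+q)=Q(p)+Q(q)+\tfrac12\int_{[M,\partial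 M]}p\cup_{n-2}q$$ for all $p,q\in Z^{n-1}(M,\partial M;\mathbb Z/2)$, and $$Q(dc)=\tfrac12\int_{[M,\partial M]}Sq^2c=\tfrac12\int_{[M,\partial M]}\bigl(c\cup_{n-4}c+c\cup_{n-3}dc\bigr)$$ for all $c\in C^{n-2}(M,\partial M;\mathbb Z/2)$, where $\tfrac12$ denotes the inclusion $\mathbb Z/2\subset\mathbb R/\mathbb Z$. Let $M'$ be the barycentric subdivision of $M$, whose simplices are the finite nonempty chains of simplices of $M$, with its canonical vertex ordering (by inclusion of simplices, which on each simplex of $M'$ is the ordering by dimension), and let $\partial M'$ be the barycentric subdivision of $\partial M$. Quadratic functions on $M'$ are defined in the same way from the pair $(M',\partial M')$. For a vertex ordering of $M$ let $b\colon(M',\partial M')\to(M,\partial M)$ be the order preserving simplicial map that sends the barycenter of a simplex $\sigma$ of $M$ to the maximum vertex of $\sigma$. 1. For every vertex ordering of $M$, the assignment $$Q'\longmapsto Q'\circ b^*,\qquad Z^{n-1}(M,\partial M;\mathbb Z/2)\xrightarrow{\,b^*\,}Z^{n-1}(M',\partial M';\mathbb Z/2)\xrightarrow{\,Q'\,}\mathbb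 R/\mathbb Z,$$ is a bijection from the set of quadratic functions on $M'$ onto the set of quadratic functions on $M$. 2. Consequently quadratic functions do not depend on the vertex ordering: for any two vertex orderings of $M$, with maps $b_1,b_2\colon M'\to M$, there is exactly one bijection $\Phi$ from the quadratic functions on $M$ for the first ordering to those for the second such that $\Phi(Q'\circ b_1^*)=Q'\circ b_2^*$ for every quadratic function $Q'$ on $M'$. -/

import Mathlib

/-! Cochains, Steenrod cup-`i` products and quadratic functions on ordered simplicial complexes. -/

namespace QuadraticCocycles

universe u v

variable {V : Type u} {W : Type v}

/-! ### Ordered simplicial complexes -/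

/-- A vertex ordering of a simplicial complex: a partial order on the vertices in which the
vertices of each simplex are totally ordered. -/
structure VertexOrder (K : PreAbstractSimplicialComplex V) where
  /-- the partial order -/
  order : PartialOrder V
  total : ∀ s ∈ K.faces, ∀ v ∈ s, ∀ w ∈ s, order.le v w ∨ order.le w v

open scoped Classical in
/-- A (weakly) order preserving simplicial map of pairs `(K, A) → (L, B)`. -/
structure OrderedMap {K : PreAbstractSimplicialComplex V} {L : PreAbstractSimplicialComplex W}
    (oK : VertexOrder K) (A : PreAbstractSimplicialComplex V)
    (oL : VertexOrder L) (B : PreAbstractSimplicialComplex W) where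
  /-- the map on vertices -/
  toFun : V → W
  map_faces : ∀ s ∈ K.faces, s.image toFun ∈ L.faces
  map_sub : ∀ s ∈ A.faces, s.image toFun ∈ B.faces
  mono : ∀ v w, {v} ∈ K.faces → {w} ∈ K.faces →
    oK.order.le v w → oL.order.le (toFun v) (toFun w)

/-! ### Simplicial cochains with `ℤ/2` coefficients

A normalized `k`-cochain of an ordered complex is determined by its values on the nondegenerate
`k`-simplices, i.e. on the faces with `k + 1` vertices. It is stored as a function on all finite
sets of vertices that vanishes away from those faces. Degrees are integers, so that the groups of
negative degree are zero. -/

/-- The relative cochains `C^k(K, A; ℤ/2)`. -/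
def relCochains (K A : PreAbstractSimplicialComplex V) (k : ℤ) :
    Submodule (ZMod 2) (Finset V → ZMod 2) where
  carrier := {c | ∀ s, ¬ (s ∈ K.faces ∧ s ∉ A.faces ∧ (s.card : ℤ) = k + 1) → c s = 0}
  add_mem' := by
    intro a b ha hb s hs
    simp [ha s hs, hb s hs]
  zero_mem' := by
    intro s _
    rfl
  smul_mem' := by
    intro r a ha s hs
    simp [ha s hs]

open scoped Classical in
/-- The simplicial coboundary. -/
noncomputable def coboundary (K : PreAbstractSimplicialComplex V) :
    (Finset V → ZMod 2) →ₗ[ZMod 2] (Finset V → ZMod 2) where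
  toFun c s := if s ∈ K.faces then ∑ v ∈ s, c (s.erase v) else 0
  map_add' a b := by
    funext s
    by_cases hs : s ∈ K.faces <;> simp [hs, Finset.sum_add_distrib]
  map_smul' r a := by
    funext s
    by_cases hs : s ∈ K.faces <;> simp [hs, Finset.mul_sum]

/-- The relative cocycles `Z^k(K, A; ℤ/2)`. -/
noncomputable def relCocycles (K A : PreAbstractSimplicialComplex V) (k : ℤ) :
    Submodule (ZMod 2) (Finset V → ZMod 2) :=
  relCochains K A k ⊓ LinearMap.ker (coboundary K)

/-! ### Steenrod's cup-`i` products

For an ordered simplex `s` and cut vertices `T = {t_0 < t_1 < ⋯ < t_i} ⊆ s`, the first factor is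
evaluated on the closed vertex intervals `[min s, t_0] ∪ [t_1, t_2] ∪ [t_3, t_4] ∪ ⋯` and the
second one on `[t_0, t_1] ∪ [t_2, t_3] ∪ ⋯`. A vertex outside `T` lies in the former
exactly when the number of cut vertices below it is even. -/

open scoped Classical in
/-- The number of cut vertices strictly below `v`. -/
noncomputable def VertexOrder.below {K : PreAbstractSimplicialComplex V} (o : VertexOrder K)
    (T : Finset V) (v : V) : ℕ :=
  (T.filter fun t => o.order.lt t v).card

open scoped Classical in
/-- The vertices of `s` on which the first factor is evaluated. -/
noncomputable def VertexOrder.leftPart {K : PreAbstractSimplicialComplex V} (o : VertexOrder K)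
    (T s : Finset V) : Finset V :=
  s.filter fun v => v ∈ T ∨ Even (o.below T v)

open scoped Classical in
/-- The vertices of `s` on which the second factor is evaluated. -/
noncomputable def VertexOrder.rightPart {K : PreAbstractSimplicialComplex V} (o : VertexOrder K)
    (T s : Finset V) : Finset V :=
  s.filter fun v => v ∈ T ∨ Odd (o.below T v)

open scoped Classical in
/-- Steenrod's product `x ∪_i y`, for cochains of arbitrary degrees `p` and `q`; it has degree
`p + q - i`. Terms with faces of the wrong dimension vanish because `x` and `y` vanish there, and
for negative `i` the product of cochains is zero (for `i = -1` the second factor is evaluated on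
the empty set). -/
noncomputable def cup {K : PreAbstractSimplicialComplex V} (o : VertexOrder K) (i : ℤ)
    (x y : Finset V → ZMod 2) : Finset V → ZMod 2 := fun s =>
  if s ∈ K.faces then
    ∑ T ∈ s.powerset.filter (fun T => (T.card : ℤ) = i + 1),
      x (o.leftPart T s) * y (o.rightPart T s)
  else 0

/-- The cochain operation `Sq^j c = c ∪_{k-j} c + c ∪_{k-j+1} dc` on cochains of degree `k`. -/
noncomputable def sq {K : PreAbstractSimplicialComplex V} (o : VertexOrder K) (j k : ℤ)
    (c : Finset V → ZMod 2) : Finset V → ZMod 2 :=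
  cup o (k - j) c c + cup o (k - j + 1) c (coboundary K c)

/-- The integral over the mod 2 fundamental chain, the sum of all `n`-simplices. -/
noncomputable def integral (K : PreAbstractSimplicialComplex V) (n : ℕ)
    (w : Finset V → ZMod 2) : ZMod 2 :=
  ∑ᶠ s ∈ {s | s ∈ K.faces ∧ s.card = n + 1}, w s

/-- Quadratic functions `Q : Z^{n-1}(K, A; ℤ/2) → ℝ/ℤ`. Here `ZMod.toAddCircle` is the inclusion
`ℤ/2 → ℝ/ℤ`, `1 ↦ 1/2`. -/
structure IsQuadratic {K : PreAbstractSimplicialComplex V} (o : VertexOrder K)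
    (A : PreAbstractSimplicialComplex V) (n : ℕ)
    (Q : relCocycles K A ((n : ℤ) - 1) → UnitAddCircle) : Prop where
  add : ∀ p q, Q (p + q) =
    Q p + Q q + ZMod.toAddCircle (integral K n (cup o ((n : ℤ) - 2) p.1 q.1))
  coboundary : ∀ c ∈ relCochains K A ((n : ℤ) - 2), ∀ p : relCocycles K A ((n : ℤ) - 1),
    p.1 = coboundary K c → Q p = ZMod.toAddCircle (integral K n (sq o 2 ((n : ℤ) - 2) c))

/-! ### Pull-back of cochains -/

open scoped Classical in
/-- The pull-back `f^* c`: a simplex on which `f` is not injective has a degenerate image, where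
normalized cochains vanish. -/
noncomputable def pullback {K : PreAbstractSimplicialComplex V}
    {L : PreAbstractSimplicialComplex W} {oK : VertexOrder K} {A : PreAbstractSimplicialComplex V}
    {oL : VertexOrder L} {B : PreAbstractSimplicialComplex W} (f : OrderedMap oK A oL B)
    (c : Finset W → ZMod 2) : Finset V → ZMod 2 := fun s =>
  if s ∈ K.faces ∧ Set.InjOn f.toFun (s : Set V) then c (s.image f.toFun) else 0

theorem pullback_mem {K : PreAbstractSimplicialComplex V}
    {L : PreAbstractSimplicialComplex W} {oK : VertexOrder K} {A : PreAbstractSimplicialComplex V}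
    {oL : VertexOrder L} {B : PreAbstractSimplicialComplex W} (f : OrderedMap oK A oL B)
    {k : ℤ} {c : Finset W → ZMod 2} (hc : c ∈ relCochains L B k) :
    pullback f c ∈ relCochains K A k := by
  classical
  intro s hs
  unfold pullback
  split_ifs with h
  · apply hc
    rintro ⟨-, h2, h3⟩
    rw [Finset.card_image_of_injOn h.2] at h3
    refine hs ⟨h.1, fun hA => h2 ?_, h3⟩
    convert f.map_sub s hA
  · rfl

theorem pullback_coboundary {K : PreAbstractSimplicialComplex V}
    {L : PreAbstractSimplicialComplex W} {oK : VertexOrder K} {A : PreAbstractSimplicialComplex V}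
    {oL : VertexOrder L} {B : PreAbstractSimplicialComplex W} (f : OrderedMap oK A oL B)
    {k : ℤ} {c : Finset W → ZMod 2} (hc : c ∈ relCochains L B k) :
    coboundary K (pullback f c) = pullback f (coboundary L c) := by
  classical
  have hempty : c ∅ = 0 := hc ∅ fun h => by simpa using (L.isRelLowerSet_faces h.1).1
  funext s
  by_cases hs : s ∈ K.faces
  swap
  · simp [coboundary, pullback, hs]
  have hmem : ∀ v, pullback f c (s.erase v) =
      if Set.InjOn f.toFun ((s.erase v : Finset V) : Set V)
        then c ((s.erase v).image f.toFun) else 0 := by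
    intro v
    unfold pullback
    by_cases hne : (s.erase v).Nonempty
    · have : s.erase v ∈ K.faces := (K.isRelLowerSet_faces hs).2 (Finset.erase_subset v s) hne
      by_cases hi : Set.InjOn f.toFun ((s.erase v : Finset V) : Set V)
      · rw [if_pos ⟨this, hi⟩, if_pos hi]
      · rw [if_neg (fun h => hi h.2), if_neg hi]
    · rw [Finset.not_nonempty_iff_eq_empty] at hne
      simp [hne, hempty]
  have hL : coboundary K (pullback f c) s =
      ∑ v ∈ s, if Set.InjOn f.toFun ((s.erase v : Finset V) : Set V)
        then c ((s.erase v).image f.toFun) else 0 := by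
    simp only [coboundary, LinearMap.coe_mk, AddHom.coe_mk, if_pos hs]
    refine Finset.sum_congr rfl fun v _ => ?_
    rw [← hmem v]
  rw [hL]
  have himg : s.image f.toFun ∈ L.faces := by convert f.map_faces s hs
  by_cases hinj : Set.InjOn f.toFun (s : Set V)
  · have hR : pullback f (coboundary L c) s =
        ∑ w ∈ s.image f.toFun, c ((s.image f.toFun).erase w) := by
      unfold pullback
      rw [if_pos ⟨hs, hinj⟩]
      simp only [coboundary, LinearMap.coe_mk, AddHom.coe_mk]
      rw [if_pos (by convert himg)]
    rw [hR, Finset.sum_image (fun a ha b hb h => hinj ha hb h)]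
    refine Finset.sum_congr rfl fun v hv => ?_
    rw [if_pos (hinj.mono (by simp))]
    congr 1
    ext w
    simp only [Finset.mem_image, Finset.mem_erase]
    constructor
    · rintro ⟨a, ⟨h1, h2⟩, rfl⟩
      exact ⟨fun h => h1 (hinj h2 hv h), a, h2, rfl⟩
    · rintro ⟨h1, a, h2, rfl⟩
      exact ⟨a, ⟨fun h => h1 (by rw [h]), h2⟩, rfl⟩
  · have hR : pullback f (coboundary L c) s = 0 := by
      unfold pullback
      rw [if_neg (fun h => hinj h.2)]
    rw [hR]
    obtain ⟨a, ha, b, hb, hab, hne⟩ : ∃ a ∈ s, ∃ b ∈ s, f.toFun a = f.toFun b ∧ a ≠ b := by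
      simpa [Set.InjOn] using hinj
    have hsub : ∑ v ∈ ({a, b} : Finset V),
        (if Set.InjOn f.toFun ((s.erase v : Finset V) : Set V)
          then c ((s.erase v).image f.toFun) else 0) =
        ∑ v ∈ s, if Set.InjOn f.toFun ((s.erase v : Finset V) : Set V)
          then c ((s.erase v).image f.toFun) else 0 := by
      refine Finset.sum_subset (by intro x; simp; rintro (rfl | rfl) <;> assumption) ?_
      intro x _ hx
      simp only [Finset.mem_insert, Finset.mem_singleton, not_or] at hx
      rw [if_neg]
      intro hi
      exact hne (hi (by simp [ha, Ne.symm hx.1]) (by simp [hb, Ne.symm hx.2]) hab)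
    rw [← hsub, Finset.sum_pair hne]
    have key : ∀ x y, x ∈ s → y ∈ s → f.toFun x = f.toFun y → x ≠ y →
        Set.InjOn f.toFun ((s.erase x : Finset V) : Set V) →
        Set.InjOn f.toFun ((s.erase y : Finset V) : Set V) := by
      intro x y hx hy hxy hxne hi p hp q hq hpq
      simp only [Finset.coe_erase, Set.mem_sdiff, Finset.mem_coe, Set.mem_singleton_iff] at hp hq
      by_cases h1 : p = x <;> by_cases h2 : q = x
      · rw [h1, h2]
      · exact absurd (hi (by simp [hy, hxne.symm]) (by simp [hq.1, h2])
          (by rw [← hxy, ← h1, hpq])) (Ne.symm hq.2)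
      · exact absurd (hi (by simp [hp.1, h1]) (by simp [hy, hxne.symm])
          (by rw [← hxy, ← h2, hpq])) hp.2
      · exact hi (by simp [hp.1, h1]) (by simp [hq.1, h2]) hpq
    have himage : ∀ x y, x ∈ s → y ∈ s → f.toFun x = f.toFun y → x ≠ y →
        (s.erase x).image f.toFun = s.image f.toFun := by
      intro x y hx hy hxy hxne
      apply Finset.Subset.antisymm (Finset.image_subset_image (Finset.erase_subset _ _))
      intro w hw
      obtain ⟨z, hz, rfl⟩ := Finset.mem_image.1 hw
      by_cases hzx : z = x
      · exact Finset.mem_image.2 ⟨y, by simp [hy, hxne.symm], by rw [hzx, hxy]⟩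
      · exact Finset.mem_image.2 ⟨z, by simp [hz, hzx], rfl⟩
    rw [himage a b ha hb hab hne, himage b a hb ha hab.symm hne.symm]
    have hiff := (⟨key a b ha hb hab hne, key b a hb ha hab.symm hne.symm⟩ :
      Set.InjOn f.toFun ((s.erase a : Finset V) : Set V) ↔ _)
    simp only [hiff]
    exact CharTwo.add_self_eq_zero _

/-- The map `f^* : Z^k(L, B; ℤ/2) → Z^k(K, A; ℤ/2)`. -/
noncomputable def pullbackCocycle {K : PreAbstractSimplicialComplex V}
    {L : PreAbstractSimplicialComplex W} {oK : VertexOrder K} {A : PreAbstractSimplicialComplex V}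
    {oL : VertexOrder L} {B : PreAbstractSimplicialComplex W} (f : OrderedMap oK A oL B) (k : ℤ)
    (p : relCocycles L B k) : relCocycles K A k :=
  ⟨pullback f p.1, pullback_mem f p.2.1, by
    have h : coboundary L p.1 = 0 := p.2.2
    change coboundary K (pullback f p.1) = 0
    rw [pullback_coboundary f p.2.1, h]
    funext s
    simp [pullback]⟩

/-! ### Barycentric subdivision -/

/-- The barycentric subdivision of a subcomplex `A` of `K`, as a complex whose vertices are among
the simplices of `K` (standing for their barycenters): its simplices are the nonempty finite
chains, under inclusion, of simplices of `A`. -/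
def sdSub (K A : PreAbstractSimplicialComplex V) :
    PreAbstractSimplicialComplex {s : Finset V // s ∈ K.faces} where
  faces := {F | F.Nonempty ∧ IsChain (· ≤ ·) (F : Set {s : Finset V // s ∈ K.faces}) ∧
    ∀ s ∈ F, s.1 ∈ A.faces}
  isRelLowerSet_faces := by
    rintro F ⟨h1, h2, h3⟩
    exact ⟨h1, fun G hG hne => ⟨hne, h2.mono (by exact_mod_cast hG), fun s hs => h3 s (hG hs)⟩⟩

/-- The barycentric subdivision of `K`. -/
def sd (K : PreAbstractSimplicialComplex V) :
    PreAbstractSimplicialComplex {s : Finset V // s ∈ K.faces} :=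
  sdSub K K

/-- The canonical vertex ordering of the barycentric subdivision, by inclusion of simplices; on
the vertices of a simplex of the subdivision this is the ordering by dimension. -/
def sdOrder (K : PreAbstractSimplicialComplex V) : VertexOrder (sd K) where
  order := inferInstance
  total := by
    rintro F ⟨-, h2, -⟩ s hs t ht
    exact h2.total hs ht

theorem VertexOrder.exists_max {K : PreAbstractSimplicialComplex V} (o : VertexOrder K)
    (s : Finset V) (hs : s ∈ K.faces) : ∃ v ∈ s, ∀ w ∈ s, o.order.le w v := by
  let _ := o.order
  obtain ⟨v, hv⟩ := s.exists_maximal (K.isRelLowerSet_faces hs).1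
  refine ⟨v, hv.1, fun w hw => ?_⟩
  rcases o.total s hs w hw v hv.1 with h | h
  · exact h
  · exact hv.2 hw h

/-- The maximum vertex of a simplex. -/
noncomputable def VertexOrder.maxVertex {K : PreAbstractSimplicialComplex V} (o : VertexOrder K)
    (s : {s : Finset V // s ∈ K.faces}) : V :=
  (o.exists_max s.1 s.2).choose

theorem VertexOrder.maxVertex_mem {K : PreAbstractSimplicialComplex V} (o : VertexOrder K)
    (s : {s : Finset V // s ∈ K.faces}) : o.maxVertex s ∈ s.1 :=
  (o.exists_max s.1 s.2).choose_spec.1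

theorem VertexOrder.le_maxVertex {K : PreAbstractSimplicialComplex V} (o : VertexOrder K)
    (s : {s : Finset V // s ∈ K.faces}) (w : V) (hw : w ∈ s.1) :
    o.order.le w (o.maxVertex s) :=
  (o.exists_max s.1 s.2).choose_spec.2 w hw

open scoped Classical in
theorem VertexOrder.image_maxVertex_mem {K : PreAbstractSimplicialComplex V} (o : VertexOrder K)
    (A : PreAbstractSimplicialComplex V) (F : Finset {s : Finset V // s ∈ K.faces})
    (hF : F ∈ (sdSub K A).faces) : F.image o.maxVertex ∈ A.faces := by
  obtain ⟨h1, h2, h3⟩ := hF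
  obtain ⟨t, ht⟩ := F.exists_maximal h1
  refine (A.isRelLowerSet_faces (h3 t ht.1)).2 ?_ (h1.image _)
  intro v hv
  obtain ⟨s, hs, rfl⟩ := Finset.mem_image.1 hv
  have hst : s ≤ t := by
    rcases h2.total hs ht.1 with h | h
    · exact h
    · exact ht.2 hs h
  exact hst (o.maxVertex_mem s)

/-- The canonical order preserving simplicial map `b : (K', A') → (K, A)` from the barycentric
subdivision, which sends the barycenter of a simplex to the maximum vertex of that simplex. -/
noncomputable def barycentricMap {K : PreAbstractSimplicialComplex V} (o : VertexOrder K)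
    (A : PreAbstractSimplicialComplex V) : OrderedMap (sdOrder K) (sdSub K A) o A where
  toFun := o.maxVertex
  map_faces := o.image_maxVertex_mem K
  map_sub := o.image_maxVertex_mem A
  mono := fun s t _ _ h => o.le_maxVertex t _ (h (o.maxVertex_mem s))

/-! ### Triangulated manifolds -/

open scoped Classical in
/-- The simplicial boundary on `ℤ/2`-chains, with the empty set as a simplex of dimension `-1`. -/
noncomputable def chainBoundary (V : Type u) :
    (Finset V →₀ ZMod 2) →ₗ[ZMod 2] (Finset V →₀ ZMod 2) :=
  Finsupp.lsum (ZMod 2) fun s => LinearMap.toSpanSingleton (ZMod 2) (Finset V →₀ ZMod 2)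
    (∑ v ∈ s, Finsupp.single (s.erase v) 1)

/-- The augmented simplicial chains of degree `k`. -/
noncomputable def augChains (X : PreAbstractSimplicialComplex V) (k : ℤ) :
    Submodule (ZMod 2) (Finset V →₀ ZMod 2) :=
  Finsupp.supported (ZMod 2) (ZMod 2) {s | (s ∈ X.faces ∨ s = ∅) ∧ (s.card : ℤ) = k + 1}

/-- The augmented simplicial cycles of degree `k`. -/
noncomputable def augCycles (X : PreAbstractSimplicialComplex V) (k : ℤ) :
    Submodule (ZMod 2) (Finset V →₀ ZMod 2) :=
  augChains X k ⊓ LinearMap.ker (chainBoundary V)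

/-- The reduced simplicial homology `H̃_k(X; ℤ/2)`. -/
abbrev ReducedHomology (X : PreAbstractSimplicialComplex V) (k : ℤ) : Type u :=
  augCycles X k ⧸
    (((augChains X (k + 1)).map (chainBoundary V)).comap (augCycles X k).subtype :
      Submodule (ZMod 2) (augCycles X k))

/-- `X` has the mod 2 homology of a point. -/
def IsAcyclic (X : PreAbstractSimplicialComplex V) : Prop :=
  ∀ k : ℤ, Subsingleton (ReducedHomology X k)

/-- `X` has the mod 2 homology of a sphere of dimension `d` (the sphere of dimension `-1` is
empty). -/
def IsHomologySphere (X : PreAbstractSimplicialComplex V) (d : ℤ) : Prop :=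
  Nonempty (ReducedHomology X d ≃ₗ[ZMod 2] ZMod 2) ∧
    ∀ k : ℤ, k ≠ d → Subsingleton (ReducedHomology X k)

open scoped Classical in
/-- The link of `s` in `K`. -/
def link (K : PreAbstractSimplicialComplex V) (s : Finset V) : PreAbstractSimplicialComplex V where
  faces := {t | t.Nonempty ∧ Disjoint t s ∧ t ∪ s ∈ K.faces}
  isRelLowerSet_faces := by
    rintro t ⟨h1, h2, h3⟩
    exact ⟨h1, fun r hr hne => ⟨hne, h2.mono_left hr,
      (K.isRelLowerSet_faces h3).2 (Finset.union_subset_union_left hr)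
        (hne.mono Finset.subset_union_left)⟩⟩

/-- `K` is a compact triangulated `n`-manifold with boundary the subcomplex `A`, in the broad sense
of mod 2 homology manifolds: a finite complex in which the link of a `k`-simplex has the mod 2
homology of the `(n - k - 1)`-sphere if the simplex is not in `A`, and that of a point if it is. -/
structure IsTriangulatedManifold (K A : PreAbstractSimplicialComplex V) (n : ℕ) : Prop where
  finite : K.faces.Finite
  sub : A ≤ K
  link_interior : ∀ s ∈ K.faces, s ∉ A.faces →
    IsHomologySphere (link K s) ((n : ℤ) - s.card)
  link_boundary : ∀ s ∈ A.faces, IsAcyclic (link K s)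

end QuadraticCocycles

namespace QuadraticCocycles

open scoped Classical

universe u v

/-! ### Augmented mod 2 chains, cones and push-forward. -/

section Chains

variable {V : Type u} {W : Type v}

/-! Subdivision of chains, `sdChain`, is built by coning the subdivided boundary of each simplex
from its barycenter. The map `b` of the theorem is a strict left inverse on normalized chains
(`pushforward_sdChain`), and the other composite is homotopic to the identity by a homotopy that
stays below the given flag and so respects the boundary subcomplex. Write `s` for the dual of
subdivision (`sdCochain`) and `h` for the dual homotopy (`sdHomotopy`). Then `s b^* = 1` and `b^* s
= 1 + d h + h d` on relative cochains, so every cocycle of the subdivision is `p = b^* s p + d h p`.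

The two axioms therefore force `Q'(p) = Q(s p) + ½∫Sq²(h p) + ½∫ b^* s p ∪_{n-2} d h p` with `Q = Q'
∘ b^*`, which gives injectivity (`IsQuadratic.apply_sd`). For surjectivity the same formula is taken
as a definition (`sdExtend`), and one checks that it is quadratic and restricts to `Q`.

The checks rest on three facts about integrals. Stokes' theorem `integral_coboundary` holds because
an interior simplex of codimension one has an even number of cofaces. The subdivided fundamental
chain is the fundamental chain of the subdivision, so `∫ x = ∫ s x` (`integral_sd`); this carries
Stokes to the subdivision and, by naturality of the products (`pullback_cup`), shows that `b^*`
preserves the integrals in the axioms. Finally, Steenrod's formula for `d(x ∪_i y)`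
(`coboundary_cup`) combined with Stokes gives: `∫ p ∪_{n-2} q` is symmetric on cocycles, `∫Sq²` is
additive up to `∫ dc ∪_{n-2} de`, and `∫Sq²` vanishes on coboundaries.

The second part is formal: the bijection is the inverse of the one for the first ordering followed
by the one for the second. -/

theorem chain_hom_ext {M : Type*} [AddCommGroup M] [Module (ZMod 2) M]
    {f g : (Finset V →₀ ZMod 2) →ₗ[ZMod 2] M}
    (h : ∀ s, f (Finsupp.single s 1) = g (Finsupp.single s 1)) : f = g := by
  refine Finsupp.lhom_ext' fun s => LinearMap.ext_ring ?_
  simpa using h s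

theorem chain_add_self {M : Type*} [AddCommGroup M] [Module (ZMod 2) M] (x : M) : x + x = 0 := by
  have h : ((1 : ZMod 2) + 1) • x = x + x := by rw [add_smul, one_smul]
  rw [← h, CharTwo.add_self_eq_zero, zero_smul]

theorem chainBoundary_single (s : Finset V) :
    chainBoundary V (Finsupp.single s 1) = ∑ v ∈ s, Finsupp.single (s.erase v) 1 := by
  simp [chainBoundary]

/-- The cone with apex `v` on a chain. -/
noncomputable def cone (v : V) : (Finset V →₀ ZMod 2) →ₗ[ZMod 2] (Finset V →₀ ZMod 2) :=
  Finsupp.linearCombination (ZMod 2) fun s =>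
    if v ∈ s then 0 else Finsupp.single (insert v s) 1

theorem cone_single (v : V) (s : Finset V) : cone v (Finsupp.single s 1) =
    if v ∈ s then 0 else Finsupp.single (insert v s) 1 := by
  simp [cone]

theorem cone_single_erase {v : V} {s : Finset V} (hv : v ∈ s) :
    cone v (Finsupp.single (s.erase v) 1) = Finsupp.single s 1 := by
  rw [cone_single, if_neg (Finset.notMem_erase v s), Finset.insert_erase hv]

theorem cone_single_of_mem {v : V} {s : Finset V} (hv : v ∈ s) :
    cone v (Finsupp.single s 1) = 0 := by
  rw [cone_single, if_pos hv]

/-- The cone is a contracting homotopy of the augmented chains. -/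
theorem chainBoundary_cone (v : V) (x : Finset V →₀ ZMod 2) :
    chainBoundary V (cone v x) = x + cone v (chainBoundary V x) := by
  suffices h : chainBoundary V ∘ₗ cone v = LinearMap.id + cone v ∘ₗ chainBoundary V from
    LinearMap.congr_fun h x
  refine chain_hom_ext fun s => ?_
  simp only [LinearMap.comp_apply, LinearMap.add_apply, LinearMap.id_apply, chainBoundary_single,
    map_sum]
  by_cases hv : v ∈ s
  · rw [cone_single_of_mem hv, map_zero, ← Finset.add_sum_erase s _ hv, cone_single_erase hv,
      Finset.sum_eq_zero, add_zero, chain_add_self]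
    intro w hw
    exact cone_single_of_mem (Finset.mem_erase.2 ⟨(Finset.ne_of_mem_erase hw).symm, hv⟩)
  · rw [cone_single, if_neg hv, chainBoundary_single, Finset.sum_insert hv, Finset.erase_insert hv]
    congr 1
    refine Finset.sum_congr rfl fun w hw => ?_
    have hvw : v ≠ w := fun h => hv (h ▸ hw)
    rw [cone_single, if_neg (fun h => hv (Finset.mem_of_mem_erase h)),
      Finset.erase_insert_of_ne hvw]

/-- A nonempty simplex is the cone `v * s` over a face, and `∂∂(v * s) = ∂(s + v * ∂s) = 2∂s + v *
∂∂s`, which allows induction on the number of vertices. -/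
theorem chainBoundary_chainBoundary (x : Finset V →₀ ZMod 2) :
    chainBoundary V (chainBoundary V x) = 0 := by
  suffices h : chainBoundary V ∘ₗ chainBoundary V = 0 from LinearMap.congr_fun h x
  refine chain_hom_ext fun s => ?_
  simp only [LinearMap.comp_apply, LinearMap.zero_apply]
  induction s using Finset.induction_on with
  | empty => simp [chainBoundary_single]
  | insert v s hv ih =>
    have h : Finsupp.single (insert v s) (1 : ZMod 2) = cone v (Finsupp.single s 1) := by
      rw [cone_single, if_neg hv]
    rw [h, chainBoundary_cone, map_add, chainBoundary_cone, ih, map_zero, add_zero, chain_add_self]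

/-- The map on normalized chains induced by a map of vertices. -/
noncomputable def pushforward (f : V → W) :
    (Finset V →₀ ZMod 2) →ₗ[ZMod 2] (Finset W →₀ ZMod 2) :=
  Finsupp.linearCombination (ZMod 2) fun s =>
    if Set.InjOn f (s : Set V) then Finsupp.single (s.image f) 1 else 0

theorem pushforward_single (f : V → W) (s : Finset V) : pushforward f (Finsupp.single s 1) =
    if Set.InjOn f (s : Set V) then Finsupp.single (s.image f) 1 else 0 := by
  simp [pushforward]

/-- Degenerate images agree on both sides: `f` is injective on `v * s` exactly when it is injective
on `s` and `f v` is a new vertex, and otherwise both sides are zero. Together with the cone formula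
this makes `pushforward` a chain map. -/
theorem pushforward_cone (f : V → W) (v : V) (x : Finset V →₀ ZMod 2) :
    pushforward f (cone v x) = cone (f v) (pushforward f x) := by
  suffices h : pushforward f ∘ₗ cone v = cone (f v) ∘ₗ pushforward f from LinearMap.congr_fun h x
  refine chain_hom_ext fun s => ?_
  simp only [LinearMap.comp_apply]
  by_cases hv : v ∈ s
  · rw [cone_single_of_mem hv, map_zero, pushforward_single]
    split_ifs
    · rw [cone_single_of_mem (Finset.mem_image_of_mem f hv)]
    · rw [map_zero]
  · rw [cone_single, if_neg hv, pushforward_single, pushforward_single]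
    have h : Set.InjOn f ((insert v s : Finset V) : Set V) ↔
        Set.InjOn f (s : Set V) ∧ f v ∉ s.image f := by
      rw [Finset.coe_insert, Set.injOn_insert (by simpa using hv)]
      simp
    by_cases hs : Set.InjOn f (s : Set V)
    · rw [if_pos hs, cone_single, Finset.image_insert]
      by_cases hfv : f v ∈ s.image f
      · rw [if_neg (fun h' => (h.1 h').2 hfv), if_pos hfv]
      · rw [if_pos (h.2 ⟨hs, hfv⟩), if_neg hfv]
    · rw [if_neg hs, if_neg (fun h' => hs (h.1 h').1), map_zero]

theorem pushforward_chainBoundary (f : V → W) (x : Finset V →₀ ZMod 2) :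
    pushforward f (chainBoundary V x) = chainBoundary W (pushforward f x) := by
  suffices h : pushforward f ∘ₗ chainBoundary V = chainBoundary W ∘ₗ pushforward f from
    LinearMap.congr_fun h x
  refine chain_hom_ext fun s => ?_
  simp only [LinearMap.comp_apply]
  induction s using Finset.induction_on with
  | empty => simp [chainBoundary_single, pushforward_single]
  | insert v s hv ih =>
    have h : Finsupp.single (insert v s) (1 : ZMod 2) = cone v (Finsupp.single s 1) := by
      rw [cone_single, if_neg hv]
    rw [h, chainBoundary_cone, map_add, pushforward_cone, pushforward_cone, chainBoundary_cone, ih]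

/-- The coefficients of a cone. -/
theorem cone_apply [inst : DecidableEq V] (v : V) (x : Finset V →₀ ZMod 2) (s : Finset V) :
    cone v x s = if v ∈ s then x (s.erase v) else 0 := by
  -- `erase` depends on the instance, which is arbitrary here; `cone` is built with the classical
  -- one.
  obtain rfl : inst = fun a b => Classical.propDecidable (a = b) := Subsingleton.elim _ _
  suffices h : Finsupp.lapply s ∘ₗ cone v =
      if v ∈ s then Finsupp.lapply (s.erase v) else (0 : (Finset V →₀ ZMod 2) →ₗ[ZMod 2] ZMod 2) by
    have h' := LinearMap.congr_fun h x
    simp only [LinearMap.comp_apply, Finsupp.lapply_apply] at h'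
    rw [h']
    split_ifs <;> simp
  refine chain_hom_ext fun t => ?_
  rw [LinearMap.comp_apply, Finsupp.lapply_apply, cone_single]
  by_cases hs : v ∈ s
  · rw [if_pos hs, Finsupp.lapply_apply]
    by_cases ht : v ∈ t
    · rw [if_pos ht, Finsupp.single_apply, if_neg]
      · rfl
      · rintro rfl
        exact Finset.notMem_erase v s ht
    · rw [if_neg ht, Finsupp.single_apply, Finsupp.single_apply]
      congr 1
      refine propext ⟨?_, ?_⟩
      · rintro rfl
        exact (Finset.erase_insert ht).symm
      · rintro rfl
        exact Finset.insert_erase hs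
  · rw [if_neg hs]
    by_cases ht : v ∈ t
    · rw [if_pos ht]
      rfl
    · rw [if_neg ht, Finsupp.single_apply, if_neg]
      · rfl
      · rintro rfl
        exact hs (Finset.mem_insert_self v t)

end Chains

/-! ### The cone homotopy on flags of a partial order. -/

section Homotopy

variable {P : Type u} [PartialOrder P]

/-- The homotopy between the identity and a chain map `φ` that is carried by the cones below the
maxima of chains, on chains with `k` elements. -/
noncomputable def coneHomotopyAux (φ : (Finset P →₀ ZMod 2) →ₗ[ZMod 2] (Finset P →₀ ZMod 2)) :
    ℕ → Finset P → (Finset P →₀ ZMod 2)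
  | 0, _ => 0
  | k + 1, F => if h : ∃ t ∈ F, ∀ s ∈ F, s ≤ t then
      cone h.choose (φ (Finsupp.single F 1) + coneHomotopyAux φ k (F.erase h.choose)) else 0

/-- The homotopy between the identity and a chain map `φ` that is carried by the cones below the
maxima of chains. -/
noncomputable def coneHomotopy (φ : (Finset P →₀ ZMod 2) →ₗ[ZMod 2] (Finset P →₀ ZMod 2)) :
    (Finset P →₀ ZMod 2) →ₗ[ZMod 2] (Finset P →₀ ZMod 2) :=
  Finsupp.linearCombination (ZMod 2) fun F => coneHomotopyAux φ F.card F

theorem coneHomotopy_empty (φ : (Finset P →₀ ZMod 2) →ₗ[ZMod 2] (Finset P →₀ ZMod 2)) :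
    coneHomotopy φ (Finsupp.single ∅ 1) = 0 := by
  simp [coneHomotopy, coneHomotopyAux]

/-- The carrier prescription is `H F = t * (F + φ F + H ∂F)`. Here `F` and the faces still
containing the top `t` drop out, because `F` contains `t`, the values of `H` on such faces are
already cones from `t`, and coning twice from `t` gives zero. Only the face `F \ t` remains. -/
theorem coneHomotopy_single (φ : (Finset P →₀ ZMod 2) →ₗ[ZMod 2] (Finset P →₀ ZMod 2))
    {F : Finset P} {t : P} (ht : t ∈ F) (hF : ∀ s ∈ F, s ≤ t) :
    coneHomotopy φ (Finsupp.single F 1) =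
      cone t (φ (Finsupp.single F 1) + coneHomotopy φ (Finsupp.single (F.erase t) 1)) := by
  have h : ∃ t ∈ F, ∀ s ∈ F, s ≤ t := ⟨t, ht, hF⟩
  have hc : h.choose = t :=
    le_antisymm (hF _ h.choose_spec.1) (h.choose_spec.2 t ht)
  obtain ⟨k, hk⟩ : ∃ k, F.card = k + 1 :=
    ⟨F.card - 1, (Nat.succ_pred_eq_of_pos (Finset.card_pos.2 ⟨t, ht⟩)).symm⟩
  have hk' : (F.erase t).card = k := by rw [Finset.card_erase_of_mem ht, hk]; rfl
  simp only [coneHomotopy, Finsupp.linearCombination_single, one_smul, hk, hk']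
  rw [coneHomotopyAux, dif_pos h, hc]

theorem exists_top_of_isChain {F : Finset P} (hF : IsChain (· ≤ ·) (F : Set P))
    (hne : F.Nonempty) : ∃ t ∈ F, ∀ s ∈ F, s ≤ t := by
  obtain ⟨t, ht⟩ := F.exists_maximal hne
  refine ⟨t, ht.1, fun s hs => ?_⟩
  rcases hF.total hs ht.1 with h | h
  · exact h
  · exact ht.2 hs h

/-- Expanding `∂(t * x) = x + t * ∂x` for `x = φ F + H(F \ t)`, and using the inductive formula for
`∂H(F \ t)`, all terms cancel in pairs except `φ F` and `t * (F \ t) = F`. The chain map property of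
`φ` is needed only on flags, which suits a `φ` that is meaningful only on simplices. -/
theorem chainBoundary_coneHomotopy
    (φ : (Finset P →₀ ZMod 2) →ₗ[ZMod 2] (Finset P →₀ ZMod 2))
    (hempty : φ (Finsupp.single ∅ 1) = Finsupp.single ∅ 1)
    (hφ : ∀ F : Finset P, IsChain (· ≤ ·) (F : Set P) →
      chainBoundary P (φ (Finsupp.single F 1)) = φ (chainBoundary P (Finsupp.single F 1)))
    (F : Finset P) (hF : IsChain (· ≤ ·) (F : Set P)) :
    chainBoundary P (coneHomotopy φ (Finsupp.single F 1)) +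
      coneHomotopy φ (chainBoundary P (Finsupp.single F 1)) =
      Finsupp.single F 1 + φ (Finsupp.single F 1) := by
  induction hk : F.card generalizing F with
  | zero =>
    obtain rfl := Finset.card_eq_zero.1 hk
    rw [coneHomotopy_empty, hempty, chainBoundary_single]
    simp [chain_add_self]
  | succ k ih =>
    obtain ⟨t, ht, htop⟩ := exists_top_of_isChain hF
      (Finset.card_pos.1 (by omega))
    have hF' : IsChain (· ≤ ·) ((F.erase t : Finset P) : Set P) :=
      hF.mono (by exact_mod_cast Finset.erase_subset t F)
    have hrec := ih (F.erase t) hF' (by rw [Finset.card_erase_of_mem ht, hk]; rfl)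
    have hside : coneHomotopy φ (chainBoundary P (Finsupp.single F 1)) =
        coneHomotopy φ (Finsupp.single (F.erase t) 1) +
          cone t (φ (∑ s ∈ F.erase t, Finsupp.single (F.erase s) 1) +
            coneHomotopy φ (chainBoundary P (Finsupp.single (F.erase t) 1))) := by
      rw [chainBoundary_single, ← Finset.add_sum_erase F _ ht, map_add, chainBoundary_single]
      congr 1
      simp only [map_sum, map_add, ← Finset.sum_add_distrib]
      refine Finset.sum_congr rfl fun s hs => ?_
      have hts : t ∈ F.erase s :=
        Finset.mem_erase.2 ⟨(Finset.ne_of_mem_erase hs).symm, ht⟩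
      rw [coneHomotopy_single φ hts fun r hr => htop r (Finset.mem_of_mem_erase hr), map_add,
        Finset.erase_right_comm]
    have hb : chainBoundary P (φ (Finsupp.single F 1)) =
        φ (Finsupp.single (F.erase t) 1) +
          φ (∑ s ∈ F.erase t, Finsupp.single (F.erase s) 1) := by
      rw [hφ F hF, chainBoundary_single, ← Finset.add_sum_erase F _ ht, map_add]
    rw [hside, coneHomotopy_single φ ht htop, chainBoundary_cone, map_add, hb]
    have hrec' : chainBoundary P (coneHomotopy φ (Finsupp.single (F.erase t) 1)) =
        Finsupp.single (F.erase t) 1 + φ (Finsupp.single (F.erase t) 1) +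
          coneHomotopy φ (chainBoundary P (Finsupp.single (F.erase t) 1)) := by
      rw [← hrec, add_assoc, chain_add_self, add_zero]
    rw [hrec']
    simp only [map_add, cone_single_erase ht]
    generalize cone t (φ (Finsupp.single (F.erase t) 1)) = a
    generalize cone t (φ (∑ s ∈ F.erase t, Finsupp.single (F.erase s) 1)) = b
    generalize cone t (coneHomotopy φ (chainBoundary P (Finsupp.single (F.erase t) 1))) = c
    generalize coneHomotopy φ (Finsupp.single (F.erase t) 1) = d
    generalize φ (Finsupp.single F 1) = e
    have ha := chain_add_self a
    have hb := chain_add_self b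
    have hc := chain_add_self c
    have hd := chain_add_self d
    calc _ = Finsupp.single F 1 + e + (a + a) + (b + b) + (c + c) + (d + d) := by abel
      _ = _ := by rw [ha, hb, hc, hd]; simp

end Homotopy

/-! ### Carriers: control of the flags that occur in a chain. -/

section Supports

variable {V : Type u}

theorem map_mem_of_supported {M : Type*} [AddCommGroup M] [Module (ZMod 2) M]
    (f : (Finset V →₀ ZMod 2) →ₗ[ZMod 2] M) {S : Set (Finset V)} {N : Submodule (ZMod 2) M}
    (h : ∀ s ∈ S, f (Finsupp.single s 1) ∈ N) {x : Finset V →₀ ZMod 2}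
    (hx : x ∈ Finsupp.supported (ZMod 2) (ZMod 2) S) : f x ∈ N := by
  rw [Finsupp.supported_eq_span_single] at hx
  have : Submodule.span (ZMod 2) ((fun i => Finsupp.single i (1 : ZMod 2)) '' S) ≤ N.comap f := by
    rw [Submodule.span_le]
    rintro _ ⟨s, hs, rfl⟩
    exact h s hs
  exact this hx

theorem map_eq_of_supported {M : Type*} [AddCommGroup M] [Module (ZMod 2) M]
    (f g : (Finset V →₀ ZMod 2) →ₗ[ZMod 2] M) {S : Set (Finset V)}
    (h : ∀ s ∈ S, f (Finsupp.single s 1) = g (Finsupp.single s 1)) {x : Finset V →₀ ZMod 2}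
    (hx : x ∈ Finsupp.supported (ZMod 2) (ZMod 2) S) : f x = g x := by
  have := map_mem_of_supported (f - g) (N := ⊥) (fun s hs => by simp [h s hs]) hx
  rw [Submodule.mem_bot, LinearMap.sub_apply] at this
  exact sub_eq_zero.1 this

variable {P : Type u} [PartialOrder P]

/-- The chains with `k` elements, all of which satisfy `p`. -/
def flagSet (p : P → Prop) (k : ℕ) : Set (Finset P) :=
  {G | IsChain (· ≤ ·) (G : Set P) ∧ G.card = k ∧ ∀ g ∈ G, p g}

theorem flagSet_mono {p q : P → Prop} (h : ∀ g, p g → q g) (k : ℕ) : flagSet p k ⊆ flagSet q k :=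
  fun _ hG => ⟨hG.1, hG.2.1, fun g hg => h g (hG.2.2 g hg)⟩

theorem cone_mem_flagSet {p : P → Prop} {t : P} (ht : p t) (hp : ∀ g, p g → g ≤ t) {k : ℕ}
    {x : Finset P →₀ ZMod 2} (hx : x ∈ Finsupp.supported (ZMod 2) (ZMod 2) (flagSet p k)) :
    cone t x ∈ Finsupp.supported (ZMod 2) (ZMod 2) (flagSet p (k + 1)) := by
  refine map_mem_of_supported (cone t) (fun G hG => ?_) hx
  rw [cone_single]
  split_ifs with h
  · exact Submodule.zero_mem _
  · refine Finsupp.single_mem_supported _ _ ⟨?_, ?_, ?_⟩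
    · rw [Finset.coe_insert]
      exact hG.1.insert fun g hg _ => Or.inr (hp g (hG.2.2 g hg))
    · rw [Finset.card_insert_of_notMem h, hG.2.1]
    · intro g hg
      rcases Finset.mem_insert.1 hg with rfl | hg
      · exact ht
      · exact hG.2.2 g hg

/-- The homotopy is only ever coned from the top of `F`, so it stays in the lower set generated by
`F`. A subcomplex is closed under passing to faces, hence the homotopy respects its subdivision. -/
theorem coneHomotopy_mem_flagSet
    (φ : (Finset P →₀ ZMod 2) →ₗ[ZMod 2] (Finset P →₀ ZMod 2))
    (hφ : ∀ F : Finset P, IsChain (· ≤ ·) (F : Set P) → φ (Finsupp.single F 1) ∈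
      Finsupp.supported (ZMod 2) (ZMod 2) (flagSet (fun g => ∃ s ∈ F, g ≤ s) F.card))
    (F : Finset P) (hF : IsChain (· ≤ ·) (F : Set P)) :
    coneHomotopy φ (Finsupp.single F 1) ∈
      Finsupp.supported (ZMod 2) (ZMod 2) (flagSet (fun g => ∃ s ∈ F, g ≤ s) (F.card + 1)) := by
  induction hk : F.card generalizing F with
  | zero =>
    obtain rfl := Finset.card_eq_zero.1 hk
    rw [coneHomotopy_empty]
    exact Submodule.zero_mem _
  | succ k ih =>
    obtain ⟨t, ht, htop⟩ := exists_top_of_isChain hF (Finset.card_pos.1 (by omega))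
    rw [coneHomotopy_single φ ht htop]
    refine cone_mem_flagSet ⟨t, ht, le_rfl⟩ ?_ (Submodule.add_mem _ ?_ ?_)
    · rintro g ⟨s, hs, hg⟩
      exact hg.trans (htop s hs)
    · rw [← hk]
      exact hφ F hF
    · refine Finsupp.supported_mono (flagSet_mono ?_ _) (ih (F.erase t) (hF.mono ?_) ?_)
      · rintro g ⟨s, hs, hg⟩
        exact ⟨s, Finset.mem_of_mem_erase hs, hg⟩
      · exact_mod_cast Finset.erase_subset t F
      · rw [Finset.card_erase_of_mem ht, hk]; rfl

end Supports

/-! ### Barycentric subdivision of chains. -/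

section Subdivision

variable {V : Type u} (K : PreAbstractSimplicialComplex V)

theorem not_empty_mem_faces : ∅ ∉ K.faces := fun h => by
  simpa using (K.isRelLowerSet_faces h).1

variable {K} in
theorem mem_faces_of_subset {s t : Finset V} (hs : s ∈ K.faces) (h : t ⊆ s) (ht : t.Nonempty) :
    t ∈ K.faces :=
  (K.isRelLowerSet_faces hs).2 h ht

variable {K} in
theorem mem_faces_or_empty_of_subset {s t : Finset V} (hs : s ∈ K.faces ∨ s = ∅) (h : t ⊆ s) :
    t ∈ K.faces ∨ t = ∅ := by
  rcases t.eq_empty_or_nonempty with rfl | ht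
  · exact Or.inr rfl
  · rcases hs with hs | rfl
    · exact Or.inl (mem_faces_of_subset hs h ht)
    · exact Or.inr (Finset.subset_empty.1 h)

/-- The barycentric subdivision of a simplex with `k` vertices, as a chain. -/
noncomputable def sdAux : ℕ → Finset V → (Finset {s : Finset V // s ∈ K.faces} →₀ ZMod 2)
  | 0, _ => Finsupp.single ∅ 1
  | k + 1, s => if h : s ∈ K.faces then cone ⟨s, h⟩ (∑ v ∈ s, sdAux k (s.erase v)) else 0

/-- Barycentric subdivision of chains. -/
noncomputable def sdChain :
    (Finset V →₀ ZMod 2) →ₗ[ZMod 2] (Finset {s : Finset V // s ∈ K.faces} →₀ ZMod 2) :=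
  Finsupp.linearCombination (ZMod 2) fun s => sdAux K s.card s

theorem sdChain_empty : sdChain K (Finsupp.single ∅ 1) = Finsupp.single ∅ 1 := by
  simp [sdChain, sdAux]

variable {K}

/-- The augmentation makes the recursion uniform: a vertex has boundary `∅`, which subdivides to
`∅`, so its subdivision is its barycenter. -/
theorem sdChain_single {s : Finset V} (hs : s ∈ K.faces) : sdChain K (Finsupp.single s 1) =
    cone ⟨s, hs⟩ (sdChain K (chainBoundary V (Finsupp.single s 1))) := by
  obtain ⟨k, hk⟩ : ∃ k, s.card = k + 1 := ⟨s.card - 1,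
    (Nat.succ_pred_eq_of_pos (Finset.card_pos.2 (K.isRelLowerSet_faces hs).1)).symm⟩
  rw [chainBoundary_single, map_sum]
  simp only [sdChain, Finsupp.linearCombination_single, one_smul, hk]
  rw [sdAux, dif_pos hs]
  congr 1
  refine Finset.sum_congr rfl fun v hv => ?_
  rw [Finset.card_erase_of_mem hv, hk]
  rfl

/-- The cone formula leaves the error `ŝ * ∂ sd ∂s`, where `ŝ` is the barycenter, and by induction
`∂ sd ∂s = sd ∂∂s = 0`. -/
theorem chainBoundary_sdChain_single {s : Finset V} (hs : s ∈ K.faces ∨ s = ∅) :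
    chainBoundary _ (sdChain K (Finsupp.single s 1)) =
      sdChain K (chainBoundary V (Finsupp.single s 1)) := by
  induction hk : s.card generalizing s with
  | zero =>
    obtain rfl := Finset.card_eq_zero.1 hk
    simp [sdChain_empty, chainBoundary_single]
  | succ k ih =>
    have hs' : s ∈ K.faces := hs.resolve_right (by rintro rfl; simp at hk)
    rw [sdChain_single hs', chainBoundary_cone, add_eq_left]
    have h : chainBoundary _ (sdChain K (chainBoundary V (Finsupp.single s 1))) =
        sdChain K (chainBoundary V (chainBoundary V (Finsupp.single s 1))) := by
      conv_lhs => rw [chainBoundary_single]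
      conv_rhs => rw [chainBoundary_single s]
      simp only [map_sum]
      refine Finset.sum_congr rfl fun v hv => ?_
      exact ih (mem_faces_or_empty_of_subset hs (Finset.erase_subset v s))
        (by rw [Finset.card_erase_of_mem hv, hk]; rfl)
    rw [h, chainBoundary_chainBoundary, map_zero, map_zero]

theorem sdChain_mem_flagSet {s : Finset V} (hs : s ∈ K.faces ∨ s = ∅) :
    sdChain K (Finsupp.single s 1) ∈
      Finsupp.supported (ZMod 2) (ZMod 2) (flagSet (fun g => g.1 ⊆ s) s.card) := by
  induction hk : s.card generalizing s with
  | zero =>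
    obtain rfl := Finset.card_eq_zero.1 hk
    rw [sdChain_empty]
    exact Finsupp.single_mem_supported _ _ ⟨by simp, rfl, by simp⟩
  | succ k ih =>
    have hs' : s ∈ K.faces := hs.resolve_right (by rintro rfl; simp at hk)
    rw [sdChain_single hs']
    refine cone_mem_flagSet (p := fun g : {s : Finset V // s ∈ K.faces} => g.1 ⊆ s)
      (Finset.Subset.refl s) (fun g hg => hg) ?_
    rw [chainBoundary_single, map_sum]
    refine Submodule.sum_mem _ fun v hv => Finsupp.supported_mono (flagSet_mono ?_ _)
      (ih (mem_faces_or_empty_of_subset hs (Finset.erase_subset v s))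
        (by rw [Finset.card_erase_of_mem hv, hk]; rfl))
    exact fun g hg => hg.trans (Finset.erase_subset v s)

/-- By induction the image is the cone over `∂s` from the maximum vertex of `s`. Facets containing
that vertex cone to zero, and the opposite facet cones to `s`. The identity is strict, with no
homotopy needed on this side. -/
theorem pushforward_sdChain (o : VertexOrder K) {s : Finset V} (hs : s ∈ K.faces ∨ s = ∅) :
    pushforward o.maxVertex (sdChain K (Finsupp.single s 1)) = Finsupp.single s 1 := by
  induction hk : s.card generalizing s with
  | zero =>
    obtain rfl := Finset.card_eq_zero.1 hk
    simp [sdChain_empty, pushforward_single]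
  | succ k ih =>
    have hs' : s ∈ K.faces := hs.resolve_right (by rintro rfl; simp at hk)
    have hm : o.maxVertex ⟨s, hs'⟩ ∈ s := o.maxVertex_mem ⟨s, hs'⟩
    have h : pushforward o.maxVertex (sdChain K (chainBoundary V (Finsupp.single s 1))) =
        chainBoundary V (Finsupp.single s 1) := by
      rw [chainBoundary_single, map_sum, map_sum]
      refine Finset.sum_congr rfl fun v hv => ?_
      exact ih (mem_faces_or_empty_of_subset hs (Finset.erase_subset v s))
        (by rw [Finset.card_erase_of_mem hv, hk]; rfl)
    rw [sdChain_single hs', pushforward_cone, h, chainBoundary_single, map_sum,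
      ← Finset.add_sum_erase s _ hm, cone_single_erase hm, Finset.sum_eq_zero, add_zero]
    intro v hv
    exact cone_single_of_mem (Finset.mem_erase.2 ⟨(Finset.ne_of_mem_erase hv).symm, hm⟩)

/-- Members of a flag are distinguished by their numbers of vertices, which lie between 1 and the
size of `t`. -/
theorem card_le_card_of_isChain {F : Finset {s : Finset V // s ∈ K.faces}}
    (hF : IsChain (· ≤ ·) (F : Set {s : Finset V // s ∈ K.faces})) {t : Finset V}
    (ht : ∀ g ∈ F, g.1 ⊆ t) : F.card ≤ t.card := by
  have h : F.card ≤ (Finset.Icc 1 t.card).card := by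
    refine Finset.card_le_card_of_injOn (fun g => g.1.card) ?_ ?_
    · intro g hg
      exact Finset.mem_coe.2 (Finset.mem_Icc.2
        ⟨Finset.card_pos.2 (K.isRelLowerSet_faces g.2).1, Finset.card_le_card (ht g hg)⟩)
    · intro g hg g' hg' h
      rcases hF.total hg hg' with h' | h'
      · exact Subtype.ext (Finset.eq_of_subset_of_card_le h' h.ge)
      · exact Subtype.ext (Finset.eq_of_subset_of_card_le h' h.le).symm
  simpa using h

/-- The subdivision of a simplex is the sum of its full flags. -/
theorem sdChain_apply {s : Finset V} (hs : s ∈ K.faces ∨ s = ∅)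
    {F : Finset {s : Finset V // s ∈ K.faces}}
    (hF : IsChain (· ≤ ·) (F : Set {s : Finset V // s ∈ K.faces})) (hcard : F.card = s.card) :
    sdChain K (Finsupp.single s 1) F = if ∀ g ∈ F, g.1 ⊆ s then 1 else 0 := by
  by_cases hsub : ∀ g ∈ F, g.1 ⊆ s
  swap
  · rw [if_neg hsub]
    by_contra h
    exact hsub ((Finsupp.mem_supported _ _).1 (sdChain_mem_flagSet hs)
      (Finset.mem_coe.2 (Finsupp.mem_support_iff.2 h))).2.2
  rw [if_pos hsub]
  induction hk : s.card generalizing s F with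
  | zero =>
    obtain rfl := Finset.card_eq_zero.1 hk
    obtain rfl := Finset.card_eq_zero.1 (hcard.trans hk)
    simp [sdChain_empty]
  | succ k ih =>
    have hs' : s ∈ K.faces := hs.resolve_right (by rintro rfl; simp at hk)
    obtain ⟨t, ht, htop⟩ := exists_top_of_isChain hF (Finset.card_pos.1 (by omega))
    -- The flag has as many members as `s` has vertices, so its top cannot be smaller than `s`.
    obtain rfl : t = ⟨s, hs'⟩ := Subtype.ext (Finset.eq_of_subset_of_card_le (hsub t ht)
      (hcard ▸ card_le_card_of_isChain hF htop))
    rw [sdChain_single hs', cone_apply, if_pos ht, chainBoundary_single, map_sum,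
      Finsupp.finsetSum_apply]
    have hF' : IsChain (· ≤ ·)
        ((F.erase ⟨s, hs'⟩ : Finset _) : Set {s : Finset V // s ∈ K.faces}) :=
      hF.mono (by exact_mod_cast Finset.erase_subset _ F)
    have hcard' : (F.erase ⟨s, hs'⟩).card = k := by
      rw [Finset.card_erase_of_mem ht, hcard, hk]; rfl
    -- Exactly one facet of `s` carries the rest of the flag: its next member omits a single vertex
    -- `w`. If nothing is left, `s` is a vertex and the facet is `∅`.
    obtain ⟨w, hw, hwF, huniq⟩ : ∃ w ∈ s, (∀ g ∈ F.erase ⟨s, hs'⟩, g.1 ⊆ s.erase w) ∧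
        ∀ v ∈ s, v ≠ w → ¬ ∀ g ∈ F.erase ⟨s, hs'⟩, g.1 ⊆ s.erase v := by
      rcases (F.erase ⟨s, hs'⟩).eq_empty_or_nonempty with he | hne
      · rw [he, Finset.card_empty] at hcard'
        obtain ⟨w, rfl⟩ := Finset.card_eq_one.1 (hk.trans (by rw [← hcard']))
        refine ⟨w, Finset.mem_singleton_self w, ?_, ?_⟩
        · rw [he]; simp
        · intro v hv hvw
          exact absurd (Finset.mem_singleton.1 hv) hvw
      · obtain ⟨t, ht', htop'⟩ := exists_top_of_isChain hF' hne
        have hts : t.1 ⊆ s := hsub t (Finset.mem_of_mem_erase ht')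
        have h1 : k ≤ t.1.card := hcard' ▸ card_le_card_of_isChain hF' htop'
        have h2 : t.1.card < s.card := Finset.card_lt_card
          (Finset.ssubset_iff_subset_ne.2 ⟨hts, fun h => Finset.ne_of_mem_erase ht'
            (Subtype.ext h)⟩)
        have h3 : (s \ t.1).card = 1 := by rw [Finset.card_sdiff_of_subset hts]; omega
        obtain ⟨w, hw⟩ := Finset.card_eq_one.1 h3
        have hw' : ∀ v, v ∈ s ∧ v ∉ t.1 ↔ v = w := fun v => by
          rw [← Finset.mem_sdiff, hw, Finset.mem_singleton]
        refine ⟨w, ((hw' w).2 rfl).1, fun g hg v hv => ?_, fun v hv hvw h => ?_⟩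
        · refine Finset.mem_erase.2 ⟨?_, hts (htop' g hg hv)⟩
          rintro rfl
          exact ((hw' v).2 rfl).2 (htop' g hg hv)
        · exact Finset.notMem_erase v s (h t ht' (by
            by_contra hvt
            exact hvw ((hw' v).1 ⟨hv, hvt⟩)))
    have herase : ∀ v ∈ s, (s.erase v).card = k := fun v hv => by
      rw [Finset.card_erase_of_mem hv, hk]; rfl
    rw [Finset.sum_eq_single_of_mem w hw]
    · exact ih (mem_faces_or_empty_of_subset hs (Finset.erase_subset w s)) hF'
        (hcard'.trans (herase w hw).symm) hwF (herase w hw)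
    · intro v hv hvw
      by_contra h
      exact huniq v hv hvw ((Finsupp.mem_supported _ _).1 (sdChain_mem_flagSet
        (mem_faces_or_empty_of_subset hs (Finset.erase_subset v s)))
        (Finset.mem_coe.2 (Finsupp.mem_support_iff.2 h))).2.2

end Subdivision

/-! ### Steenrod's coboundary formula. -/

section Steenrod

variable {V : Type u} {K : PreAbstractSimplicialComplex V} (o : VertexOrder K)

theorem VertexOrder.below_insert {T : Finset V} {t : V} (ht : t ∉ T) (v : V) :
    o.below (insert t T) v = o.below T v + if o.order.lt t v then 1 else 0 := by
  unfold VertexOrder.below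
  rw [Finset.filter_insert]
  split_ifs with h
  · rw [Finset.card_insert_of_notMem (fun h' => ht (Finset.mem_filter.1 h').1)]
  · rfl

theorem VertexOrder.leftPart_erase (T s : Finset V) (v : V) :
    o.leftPart T (s.erase v) = (o.leftPart T s).erase v :=
  Finset.filter_erase _ _ _

theorem VertexOrder.rightPart_erase (T s : Finset V) (v : V) :
    o.rightPart T (s.erase v) = (o.rightPart T s).erase v :=
  Finset.filter_erase _ _ _

theorem VertexOrder.leftPart_subset (T s : Finset V) : o.leftPart T s ⊆ s :=
  Finset.filter_subset _ _

theorem VertexOrder.rightPart_subset (T s : Finset V) : o.rightPart T s ⊆ s :=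
  Finset.filter_subset _ _

theorem VertexOrder.mem_leftPart {T s : Finset V} {v : V} :
    v ∈ o.leftPart T s ↔ v ∈ s ∧ (v ∈ T ∨ Even (o.below T v)) :=
  Finset.mem_filter

theorem VertexOrder.mem_rightPart {T s : Finset V} {v : V} :
    v ∈ o.rightPart T s ↔ v ∈ s ∧ (v ∈ T ∨ Odd (o.below T v)) :=
  Finset.mem_filter

/-- The vertices on which the first factor is evaluated, after a shift of the parity above the
`j`-th gap of `s`. -/
noncomputable def VertexOrder.gapLeft (T s : Finset V) (j : ℕ) : Finset V :=
  s.filter fun v => v ∈ T ∨ Even (o.below T v + if j ≤ o.below s v then 1 else 0)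

/-- The vertices on which the second factor is evaluated, after a shift of the parity above the
`j`-th gap of `s`. -/
noncomputable def VertexOrder.gapRight (T s : Finset V) (j : ℕ) : Finset V :=
  s.filter fun v => v ∈ T ∨ Odd (o.below T v + if j ≤ o.below s v then 1 else 0)

theorem VertexOrder.below_lt_below {s : Finset V} {v w : V} (hv : v ∈ s)
    (h : o.order.lt v w) : o.below s v < o.below s w := by
  let _ := o.order
  refine Finset.card_lt_card (Finset.ssubset_iff_of_subset ?_ |>.2 ⟨v, ?_, ?_⟩)
  · intro u hu
    rw [Finset.mem_filter] at hu ⊢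
    exact ⟨hu.1, lt_trans hu.2 h⟩
  · exact Finset.mem_filter.2 ⟨hv, h⟩
  · intro h'
    exact lt_irrefl v (Finset.mem_filter.1 h').2

theorem VertexOrder.lt_or_lt {s : Finset V} (hs : s ∈ K.faces) {v w : V} (hv : v ∈ s)
    (hw : w ∈ s) (hne : v ≠ w) : o.order.lt v w ∨ o.order.lt w v := by
  let _ := o.order
  rcases o.total s hs v hv w hw with h | h
  · exact Or.inl (lt_of_le_of_ne h hne)
  · exact Or.inr (lt_of_le_of_ne h hne.symm)

theorem VertexOrder.lt_iff_below_le {s : Finset V} (hs : s ∈ K.faces) {v w : V} (hv : v ∈ s)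
    (hw : w ∈ s) (hne : v ≠ w) : o.order.lt v w ↔ o.below s v ≤ o.below s w := by
  refine ⟨fun h => (o.below_lt_below hv h).le, fun h => ?_⟩
  rcases o.lt_or_lt hs hv hw hne with h' | h'
  · exact h'
  · exact absurd (o.below_lt_below hw h') (not_lt.2 h)

theorem VertexOrder.below_injOn {s : Finset V} (hs : s ∈ K.faces) :
    Set.InjOn (o.below s) (s : Set V) := by
  intro v hv w hw h
  by_contra hne
  rcases o.lt_or_lt hs hv hw hne with h' | h'
  · exact absurd (o.below_lt_below hv h') (by simp [h])
  · exact absurd (o.below_lt_below hw h') (by simp [h])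

theorem VertexOrder.below_lt_card {s : Finset V} {v : V} (hv : v ∈ s) : o.below s v < s.card := by
  let _ := o.order
  refine Finset.card_lt_card (Finset.ssubset_iff_of_subset (Finset.filter_subset _ _) |>.2
    ⟨v, hv, fun h' => ?_⟩)
  exact lt_irrefl v (Finset.mem_filter.1 h').2

theorem VertexOrder.sum_below {s : Finset V} (hs : s ∈ K.faces) (f : ℕ → ZMod 2) :
    ∑ v ∈ s, f (o.below s v) = ∑ j ∈ Finset.range s.card, f j := by
  have h : s.image (o.below s) = Finset.range s.card := by
    refine Finset.eq_of_subset_of_card_le ?_ ?_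
    · intro j hj
      obtain ⟨v, hv, rfl⟩ := Finset.mem_image.1 hj
      exact Finset.mem_range.2 (o.below_lt_card hv)
    · rw [Finset.card_image_of_injOn (o.below_injOn hs), Finset.card_range]
  rw [← h, Finset.sum_image (o.below_injOn hs)]

theorem sum_range_add_succ (f : ℕ → ZMod 2) (m : ℕ) :
    ∑ j ∈ Finset.range m, (f j + f (j + 1)) = f 0 + f m := by
  induction m with
  | zero => simp [CharTwo.add_self_eq_zero]
  | succ m ih =>
    rw [Finset.sum_range_succ, ih]
    have := CharTwo.add_self_eq_zero (f m)
    linear_combination this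

theorem VertexOrder.gapLeft_zero (T s : Finset V) : o.gapLeft T s 0 = o.rightPart T s := by
  refine Finset.filter_congr fun v _ => ?_
  simp [Nat.even_add_one]

theorem VertexOrder.gapRight_zero (T s : Finset V) : o.gapRight T s 0 = o.leftPart T s := by
  refine Finset.filter_congr fun v _ => ?_
  simp [Nat.odd_add_one]

theorem VertexOrder.gapLeft_card (T s : Finset V) : o.gapLeft T s s.card = o.leftPart T s := by
  refine Finset.filter_congr fun v hv => ?_
  rw [if_neg (not_le.2 (o.below_lt_card hv)), add_zero]

theorem VertexOrder.gapRight_card (T s : Finset V) : o.gapRight T s s.card = o.rightPart T s := by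
  refine Finset.filter_congr fun v hv => ?_
  rw [if_neg (not_le.2 (o.below_lt_card hv)), add_zero]

theorem VertexOrder.gap_step_of_mem {T s : Finset V} (hs : s ∈ K.faces) {t : V} (ht : t ∈ s)
    (htT : t ∈ T) : o.gapLeft T s (o.below s t + 1) = o.gapLeft T s (o.below s t) ∧
      o.gapRight T s (o.below s t + 1) = o.gapRight T s (o.below s t) := by
  have key : ∀ v ∈ s, v ∉ T → (o.below s t + 1 ≤ o.below s v ↔ o.below s t ≤ o.below s v) := by
    intro v hv hvT
    have hne : o.below s t ≠ o.below s v := fun h => hvT (o.below_injOn hs ht hv h ▸ htT)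
    omega
  constructor <;>
  · refine Finset.filter_congr fun v hv => ?_
    by_cases hvT : v ∈ T
    · simp [hvT]
    · simp only [key v hv hvT]

/-- Adding the cut vertex `t` flips the parity of all vertices above `t` and puts `t` in both parts.
Erasing `t` from one part is then the same as flipping parities from the gap just before `t` or just
after `t`; the parity of `below T t` decides which erasure belongs to which gap. -/
theorem VertexOrder.gap_of_notMem {T s : Finset V} (hs : s ∈ K.faces) {t : V} (ht : t ∈ s)
    (htT : t ∉ T) (x y : Finset V → ZMod 2) :
    x ((o.leftPart (insert t T) s).erase t) * y (o.rightPart (insert t T) s) +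
      x (o.leftPart (insert t T) s) * y ((o.rightPart (insert t T) s).erase t) =
    x (o.gapLeft T s (o.below s t)) * y (o.gapRight T s (o.below s t)) +
      x (o.gapLeft T s (o.below s t + 1)) * y (o.gapRight T s (o.below s t + 1)) := by
  have key : ∀ v ∈ s, v ≠ t → (o.below s t + 1 ≤ o.below s v ↔ o.order.lt t v) ∧
      (o.below s t ≤ o.below s v ↔ o.order.lt t v) := by
    intro v hv hvt
    have h := o.lt_iff_below_le hs ht hv (Ne.symm hvt)
    refine ⟨?_, h.symm⟩
    have hne : o.below s t ≠ o.below s v := fun h => hvt (o.below_injOn hs ht hv h).symm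
    rw [h]
    omega
  have hL : ∀ v ∈ s, v ≠ t → ∀ j, (j = o.below s t ∨ j = o.below s t + 1) →
      (v ∈ o.gapLeft T s j ↔ v ∈ o.leftPart (insert t T) s) := by
    intro v hv hvt j hj
    rw [VertexOrder.gapLeft, Finset.mem_filter, o.mem_leftPart, o.below_insert htT,
      Finset.mem_insert]
    have hj' : j ≤ o.below s v ↔ o.order.lt t v := by
      rcases hj with rfl | rfl
      · exact (key v hv hvt).2
      · exact (key v hv hvt).1
    simp only [hj', hvt, false_or]
  have hR : ∀ v ∈ s, v ≠ t → ∀ j, (j = o.below s t ∨ j = o.below s t + 1) →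
      (v ∈ o.gapRight T s j ↔ v ∈ o.rightPart (insert t T) s) := by
    intro v hv hvt j hj
    rw [VertexOrder.gapRight, Finset.mem_filter, o.mem_rightPart, o.below_insert htT,
      Finset.mem_insert]
    have hj' : j ≤ o.below s v ↔ o.order.lt t v := by
      rcases hj with rfl | rfl
      · exact (key v hv hvt).2
      · exact (key v hv hvt).1
    simp only [hj', hvt, false_or]
  have htL : t ∈ o.leftPart (insert t T) s := o.mem_leftPart.2 ⟨ht, by simp⟩
  have htR : t ∈ o.rightPart (insert t T) s := o.mem_rightPart.2 ⟨ht, by simp⟩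
  have full : ∀ A B : Finset V, A ⊆ s → (∀ v ∈ s, v ≠ t → (v ∈ A ↔ v ∈ B)) → B ⊆ s →
      t ∈ B → (t ∈ A → A = B) ∧ (t ∉ A → A = B.erase t) := by
    intro A B hA hAB hB htB
    refine ⟨fun htA => ?_, fun htA => ?_⟩
    · ext v
      by_cases hvt : v = t
      · simp [hvt, htA, htB]
      · exact ⟨fun h => (hAB v (hA h) hvt).1 h, fun h => (hAB v (hB h) hvt).2 h⟩
    · ext v
      rw [Finset.mem_erase]
      by_cases hvt : v = t
      · simp [hvt, htA]
      · exact ⟨fun h => ⟨hvt, (hAB v (hA h) hvt).1 h⟩, fun h => (hAB v (hB h.2) hvt).2 h.2⟩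
  have fL := fun j hj => full (o.gapLeft T s j) _ (Finset.filter_subset _ _)
    (fun v hv hvt => hL v hv hvt j hj) (o.leftPart_subset _ _) htL
  have fR := fun j hj => full (o.gapRight T s j) _ (Finset.filter_subset _ _)
    (fun v hv hvt => hR v hv hvt j hj) (o.rightPart_subset _ _) htR
  have mL : ∀ j, t ∈ o.gapLeft T s j ↔
      Even (o.below T t + if j ≤ o.below s t then 1 else 0) := fun j => by
    simp [VertexOrder.gapLeft, ht, htT]
  have mR : ∀ j, t ∈ o.gapRight T s j ↔
      Odd (o.below T t + if j ≤ o.below s t then 1 else 0) := fun j => by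
    simp [VertexOrder.gapRight, ht, htT]
  rcases Nat.even_or_odd (o.below T t) with he | ho
  · rw [(fL _ (Or.inl rfl)).2 (by rw [mL]; simpa [Nat.even_add_one] using he),
      (fR _ (Or.inl rfl)).1 (by rw [mR]; simpa [Nat.odd_add_one] using he),
      (fL _ (Or.inr rfl)).1 (by rw [mL]; simpa using he),
      (fR _ (Or.inr rfl)).2 (by rw [mR]; simpa using he)]
  · rw [(fL _ (Or.inl rfl)).1 (by rw [mL]; simpa [Nat.even_add_one] using ho),
      (fR _ (Or.inl rfl)).2 (by rw [mR]; simpa [Nat.odd_add_one] using ho),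
      (fL _ (Or.inr rfl)).2 (by rw [mL]; simpa using ho),
      (fR _ (Or.inr rfl)).1 (by rw [mR]; simpa using ho), add_comm]

/-- Moving the extra cut vertex through the simplex telescopes. -/
theorem VertexOrder.sum_gap {T s : Finset V} (hs : s ∈ K.faces) (x y : Finset V → ZMod 2) :
    ∑ t ∈ s \ T, (x ((o.leftPart (insert t T) s).erase t) * y (o.rightPart (insert t T) s) +
      x (o.leftPart (insert t T) s) * y ((o.rightPart (insert t T) s).erase t)) =
    x (o.leftPart T s) * y (o.rightPart T s) + y (o.leftPart T s) * x (o.rightPart T s) := by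
  have h1 : ∑ t ∈ s \ T, (x ((o.leftPart (insert t T) s).erase t) * y (o.rightPart (insert t T) s) +
      x (o.leftPart (insert t T) s) * y ((o.rightPart (insert t T) s).erase t)) =
      ∑ t ∈ s, (x (o.gapLeft T s (o.below s t)) * y (o.gapRight T s (o.below s t)) +
      x (o.gapLeft T s (o.below s t + 1)) * y (o.gapRight T s (o.below s t + 1))) := by
    -- A vertex of `T` may be included in the sum: it lies in both parts whatever the shift, so its
    -- two adjacent gaps give equal terms, which cancel. The sum then runs over all positions of `s`
    -- and telescopes.
    rw [← Finset.sum_subset (Finset.sdiff_subset (s := s) (t := T))]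
    · refine Finset.sum_congr rfl fun t ht => ?_
      rw [Finset.mem_sdiff] at ht
      exact o.gap_of_notMem hs ht.1 ht.2 x y
    · intro t ht htT
      have htT' : t ∈ T := by simpa [ht] using htT
      rw [(o.gap_step_of_mem hs ht htT').1, (o.gap_step_of_mem hs ht htT').2]
      exact CharTwo.add_self_eq_zero _
  rw [h1, o.sum_below hs (fun j => x (o.gapLeft T s j) * y (o.gapRight T s j) +
    x (o.gapLeft T s (j + 1)) * y (o.gapRight T s (j + 1))),
    sum_range_add_succ (fun j => x (o.gapLeft T s j) * y (o.gapRight T s j)),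
    o.gapLeft_zero, o.gapRight_zero, o.gapLeft_card, o.gapRight_card]
  ring

theorem coboundary_apply_of_subset {s t : Finset V} (hs : s ∈ K.faces) (ht : t ⊆ s)
    (x : Finset V → ZMod 2) :
    coboundary K x t = ∑ v ∈ s, if v ∈ t then x (t.erase v) else 0 := by
  rw [← Finset.sum_filter, Finset.filter_mem_eq_inter, Finset.inter_eq_right.2 ht]
  rcases t.eq_empty_or_nonempty with rfl | hne
  · simp [coboundary, not_empty_mem_faces]
  · simp [coboundary, mem_faces_of_subset hs ht hne]

/-- Steenrod's coboundary formula for the cup-`i` products. -/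
theorem coboundary_cup (i : ℤ) (x y : Finset V → ZMod 2) (hx : x ∅ = 0) :
    coboundary K (cup o i x y) = cup o i (coboundary K x) y + cup o i x (coboundary K y) +
      cup o (i - 1) x y + cup o (i - 1) y x := by
  funext s
  by_cases hs : s ∈ K.faces
  swap
  · simp [coboundary, cup, hs]
  have hlhs : coboundary K (cup o i x y) s =
      ∑ T ∈ s.powerset.filter (fun T => (T.card : ℤ) = i + 1), ∑ v ∈ s \ T,
        x ((o.leftPart T s).erase v) * y ((o.rightPart T s).erase v) := by
    have h1 : ∀ v ∈ s, cup o i x y (s.erase v) =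
        ∑ T ∈ (s.erase v).powerset.filter (fun T => (T.card : ℤ) = i + 1),
          x ((o.leftPart T s).erase v) * y ((o.rightPart T s).erase v) := by
      intro v hv
      unfold cup
      split_ifs with h
      · simp only [o.leftPart_erase, o.rightPart_erase]
      · have he : s.erase v = ∅ := by
          by_contra hne
          exact h (mem_faces_of_subset hs (Finset.erase_subset v s)
            (Finset.nonempty_iff_ne_empty.2 hne))
        -- If `s` is a vertex, the product vanishes at `∅`, which is not a face, while the sum may
        -- contain `x ∅ * y ∅`; hence the hypothesis on `x`.
        refine (Finset.sum_eq_zero fun T _ => ?_).symm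
        rw [← o.leftPart_erase, he]
        simp [VertexOrder.leftPart, hx]
    simp only [coboundary, LinearMap.coe_mk, AddHom.coe_mk, if_pos hs]
    rw [Finset.sum_congr rfl h1]
    refine Finset.sum_comm' fun v T => ?_
    simp only [Finset.mem_filter, Finset.mem_powerset, Finset.mem_sdiff, Finset.subset_erase]
    tauto
  -- A vertex outside `T` lies in exactly one part, and erasing it from the other changes nothing,
  -- so these terms make up the left side of the formula. The vertices of `T`, which lie in both
  -- parts, give the excess.
  have hmid : cup o i (coboundary K x) y s + cup o i x (coboundary K y) s =
      ∑ T ∈ s.powerset.filter (fun T => (T.card : ℤ) = i + 1),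
        (∑ v ∈ s \ T, x ((o.leftPart T s).erase v) * y ((o.rightPart T s).erase v) +
          ∑ v ∈ T, (x ((o.leftPart T s).erase v) * y (o.rightPart T s) +
            x (o.leftPart T s) * y ((o.rightPart T s).erase v))) := by
    simp only [cup, if_pos hs]
    rw [← Finset.sum_add_distrib]
    refine Finset.sum_congr rfl fun T hT => ?_
    have hTs : T ⊆ s := Finset.mem_powerset.1 (Finset.mem_filter.1 hT).1
    rw [coboundary_apply_of_subset hs (o.leftPart_subset T s),
      coboundary_apply_of_subset hs (o.rightPart_subset T s), Finset.sum_mul, Finset.mul_sum,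
      ← Finset.sum_add_distrib, ← Finset.sum_sdiff hTs]
    congr 1
    · refine Finset.sum_congr rfl fun v hv => ?_
      rw [Finset.mem_sdiff] at hv
      have hl : v ∈ o.leftPart T s ↔ Even (o.below T v) := by
        simp [o.mem_leftPart, hv.1, hv.2]
      have hr : v ∈ o.rightPart T s ↔ Odd (o.below T v) := by
        simp [o.mem_rightPart, hv.1, hv.2]
      by_cases h : Even (o.below T v)
      · have h' : v ∉ o.rightPart T s := fun h' => (Nat.not_odd_iff_even.2 h) (hr.1 h')
        rw [if_pos (hl.2 h), if_neg h', Finset.erase_eq_of_notMem h', mul_zero, add_zero]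
      · have h' : v ∉ o.leftPart T s := fun h' => h (hl.1 h')
        rw [if_neg h', if_pos (hr.2 (Nat.not_even_iff_odd.1 h)), Finset.erase_eq_of_notMem h',
          zero_mul, zero_add]
    · refine Finset.sum_congr rfl fun v hv => ?_
      rw [if_pos (o.mem_leftPart.2 ⟨hTs hv, Or.inl hv⟩),
        if_pos (o.mem_rightPart.2 ⟨hTs hv, Or.inl hv⟩)]
  -- A cut set with a marked element is a smaller cut set with an extra vertex;
  -- `VertexOrder.sum_gap` evaluates the sum over the extra vertex.
  have hcut : ∑ T ∈ s.powerset.filter (fun T => (T.card : ℤ) = i + 1),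
      ∑ v ∈ T, (x ((o.leftPart T s).erase v) * y (o.rightPart T s) +
            x (o.leftPart T s) * y ((o.rightPart T s).erase v)) =
      cup o (i - 1) x y s + cup o (i - 1) y x s := by
    simp only [cup, if_pos hs]
    rw [← Finset.sum_add_distrib, ← Finset.sum_congr rfl fun T _ => o.sum_gap hs x y,
      Finset.sum_sigma', Finset.sum_sigma']
    refine Finset.sum_bij' (fun a _ => ⟨a.1.erase a.2, a.2⟩) (fun a _ => ⟨insert a.2 a.1, a.2⟩)
      ?_ ?_ ?_ ?_ ?_
    · rintro ⟨T, v⟩ h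
      simp only [Finset.mem_sigma, Finset.mem_filter, Finset.mem_powerset, Finset.mem_sdiff] at h ⊢
      refine ⟨⟨(Finset.erase_subset _ _).trans h.1.1, ?_⟩, h.1.1 h.2, Finset.notMem_erase _ _⟩
      have := Finset.card_erase_add_one h.2
      have h2 := h.1.2
      omega
    · rintro ⟨T, v⟩ h
      simp only [Finset.mem_sigma, Finset.mem_filter, Finset.mem_powerset, Finset.mem_sdiff] at h ⊢
      refine ⟨⟨Finset.insert_subset h.2.1 h.1.1, ?_⟩, Finset.mem_insert_self _ _⟩
      rw [Finset.card_insert_of_notMem h.2.2]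
      have h2 := h.1.2
      push_cast
      omega
    · rintro ⟨T, v⟩ h
      simp only [Finset.mem_sigma] at h
      simp [Finset.insert_erase h.2]
    · rintro ⟨T, v⟩ h
      simp only [Finset.mem_sigma, Finset.mem_sdiff] at h
      simp [Finset.erase_insert h.2.2]
    · rintro ⟨T, v⟩ h
      simp only [Finset.mem_sigma] at h
      simp [Finset.insert_erase h.2]
  simp only [Pi.add_apply]
  rw [hmid, Finset.sum_add_distrib, hcut, ← hlhs]
  have h1 := CharTwo.add_self_eq_zero (cup o (i - 1) x y s)
  have h2 := CharTwo.add_self_eq_zero (cup o (i - 1) y x s)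
  linear_combination -h1 - h2

end Steenrod

/-! ### Degrees, bilinearity and naturality of the products. -/

section CupProducts

variable {V : Type u} {W : Type v} {K : PreAbstractSimplicialComplex V} (o : VertexOrder K)

theorem relCochains_empty {K A : PreAbstractSimplicialComplex V} {k : ℤ} {x : Finset V → ZMod 2}
    (hx : x ∈ relCochains K A k) : x ∅ = 0 :=
  hx ∅ fun h => not_empty_mem_faces K h.1

theorem VertexOrder.card_leftPart_add_card_rightPart {T s : Finset V} (hT : T ⊆ s) :
    (o.leftPart T s).card + (o.rightPart T s).card = s.card + T.card := by
  rw [← Finset.card_union_add_card_inter]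
  congr 2
  · ext v
    rw [Finset.mem_union, o.mem_leftPart, o.mem_rightPart]
    have := Nat.even_or_odd (o.below T v)
    tauto
  · ext v
    rw [Finset.mem_inter, o.mem_leftPart, o.mem_rightPart]
    have h : ¬ (Even (o.below T v) ∧ Odd (o.below T v)) := fun h =>
      Nat.not_odd_iff_even.2 h.1 h.2
    have := @hT v
    tauto

theorem cup_mem {A : PreAbstractSimplicialComplex V} {p q i : ℤ} {x y : Finset V → ZMod 2}
    (hx : x ∈ relCochains K A p) (hy : y ∈ relCochains K A q) :
    cup o i x y ∈ relCochains K A (p + q - i) := by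
  intro s hs
  unfold cup
  split_ifs with hK
  swap
  · rfl
  refine Finset.sum_eq_zero fun T hT => ?_
  rw [Finset.mem_filter, Finset.mem_powerset] at hT
  by_contra h
  have h1 : o.leftPart T s ∈ K.faces ∧ o.leftPart T s ∉ A.faces ∧
      ((o.leftPart T s).card : ℤ) = p + 1 := by
    by_contra h'
    exact h (by rw [hx _ h', zero_mul])
  have h2 : o.rightPart T s ∈ K.faces ∧ o.rightPart T s ∉ A.faces ∧
      ((o.rightPart T s).card : ℤ) = q + 1 := by
    by_contra h'
    exact h (by rw [hy _ h', mul_zero])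
  refine hs ⟨hK, fun hA => h1.2.1 (mem_faces_of_subset hA (o.leftPart_subset T s)
    (K.isRelLowerSet_faces h1.1).1), ?_⟩
  have h3 := o.card_leftPart_add_card_rightPart hT.1
  have h4 := h1.2.2
  have h5 := h2.2.2
  have h6 := hT.2
  omega

theorem cup_add_left (i : ℤ) (x x' y : Finset V → ZMod 2) :
    cup o i (x + x') y = cup o i x y + cup o i x' y := by
  funext s
  simp only [cup, Pi.add_apply]
  split_ifs
  · simp only [add_mul, Finset.sum_add_distrib]
  · simp

theorem cup_add_right (i : ℤ) (x y y' : Finset V → ZMod 2) :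
    cup o i x (y + y') = cup o i x y + cup o i x y' := by
  funext s
  simp only [cup, Pi.add_apply]
  split_ifs
  · simp only [mul_add, Finset.sum_add_distrib]
  · simp

theorem cup_zero_left (i : ℤ) (y : Finset V → ZMod 2) : cup o i 0 y = 0 := by
  funext s
  simp [cup]

theorem cup_zero_right (i : ℤ) (x : Finset V → ZMod 2) : cup o i x 0 = 0 := by
  funext s
  simp [cup]

theorem coboundary_mem {A : PreAbstractSimplicialComplex V} {k : ℤ} {c : Finset V → ZMod 2}
    (hc : c ∈ relCochains K A k) : coboundary K c ∈ relCochains K A (k + 1) := by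
  intro s hs
  simp only [coboundary, LinearMap.coe_mk, AddHom.coe_mk]
  split_ifs with hK
  swap
  · rfl
  refine Finset.sum_eq_zero fun v hv => hc _ fun h => hs ⟨hK, fun hA => h.2.1 ?_, ?_⟩
  · exact mem_faces_of_subset hA (Finset.erase_subset v s) (K.isRelLowerSet_faces h.1).1
  · have h1 := Finset.card_erase_add_one hv
    have h2 := h.2.2
    omega

theorem coboundary_coboundary (c : Finset V → ZMod 2) :
    coboundary K (coboundary K c) = 0 := by
  funext s
  by_cases hs : s ∈ K.faces
  swap
  · simp [coboundary, hs]
  have h : ∀ t, t ⊆ s → coboundary K c t =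
      Finsupp.linearCombination (ZMod 2) c (chainBoundary V (Finsupp.single t 1)) := by
    intro t ht
    rw [chainBoundary_single, map_sum]
    simp only [Finsupp.linearCombination_single, one_smul]
    rcases t.eq_empty_or_nonempty with rfl | hne
    · simp [coboundary, not_empty_mem_faces]
    · simp [coboundary, mem_faces_of_subset hs ht hne]
  have h2 : coboundary K (coboundary K c) s = Finsupp.linearCombination (ZMod 2) c
      (chainBoundary V (chainBoundary V (Finsupp.single s 1))) := by
    conv_rhs => rw [chainBoundary_single s, map_sum, map_sum]
    rw [← Finset.sum_congr rfl fun v _ => h _ (Finset.erase_subset v s)]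
    exact if_pos hs
  rw [h2, chainBoundary_chainBoundary, map_zero]
  rfl

variable {o} {L : PreAbstractSimplicialComplex W} {A : PreAbstractSimplicialComplex V}
  {oL : VertexOrder L} {B : PreAbstractSimplicialComplex W}

theorem OrderedMap.lt_iff (f : OrderedMap o A oL B) {s : Finset V} (hs : s ∈ K.faces)
    (hf : Set.InjOn f.toFun (s : Set V)) {v w : V} (hv : v ∈ s) (hw : w ∈ s) :
    oL.order.lt (f.toFun v) (f.toFun w) ↔ o.order.lt v w := by
  have hface : ∀ u ∈ s, ({u} : Finset V) ∈ K.faces := fun u hu =>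
    mem_faces_of_subset hs (by simpa using hu) (Finset.singleton_nonempty u)
  have key : ∀ v ∈ s, ∀ w ∈ s, o.order.lt v w → oL.order.lt (f.toFun v) (f.toFun w) := by
    intro v hv w hw h
    let _ := o.order
    let _ := oL.order
    refine lt_of_le_of_ne (f.mono v w (hface v hv) (hface w hw) (le_of_lt h)) fun he => ?_
    exact ne_of_lt h (hf hv hw he)
  refine ⟨fun h => ?_, key v hv w hw⟩
  let _ := oL.order
  by_cases hne : v = w
  · exact absurd h (hne ▸ lt_irrefl (f.toFun v))
  · exact (o.lt_or_lt hs hv hw hne).resolve_right fun h' => lt_asymm h (key w hw v hv h')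

theorem OrderedMap.below_image (f : OrderedMap o A oL B) {s T : Finset V} (hs : s ∈ K.faces)
    (hf : Set.InjOn f.toFun (s : Set V)) (hT : T ⊆ s) {v : V} (hv : v ∈ s) :
    oL.below (T.image f.toFun) (f.toFun v) = o.below T v := by
  unfold VertexOrder.below
  rw [Finset.filter_image, Finset.card_image_of_injOn]
  · congr 1
    exact Finset.filter_congr fun t ht => f.lt_iff hs hf (hT ht) hv
  · exact hf.mono fun t ht => hT (Finset.mem_filter.1 (Finset.mem_coe.1 ht)).1

theorem OrderedMap.mem_image_iff (f : OrderedMap o A oL B) {s T : Finset V}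
    (hf : Set.InjOn f.toFun (s : Set V)) (hT : T ⊆ s) {v : V} (hv : v ∈ s) :
    f.toFun v ∈ T.image f.toFun ↔ v ∈ T := by
  refine ⟨fun h => ?_, fun h => Finset.mem_image_of_mem _ h⟩
  obtain ⟨t, ht, he⟩ := Finset.mem_image.1 h
  exact hf (hT ht) hv he ▸ ht

theorem OrderedMap.leftPart_image (f : OrderedMap o A oL B) {s T : Finset V} (hs : s ∈ K.faces)
    (hf : Set.InjOn f.toFun (s : Set V)) (hT : T ⊆ s) :
    oL.leftPart (T.image f.toFun) (s.image f.toFun) = (o.leftPart T s).image f.toFun := by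
  unfold VertexOrder.leftPart
  rw [Finset.filter_image]
  congr 1
  refine Finset.filter_congr fun v hv => ?_
  rw [f.below_image hs hf hT hv, f.mem_image_iff hf hT hv]

theorem OrderedMap.rightPart_image (f : OrderedMap o A oL B) {s T : Finset V} (hs : s ∈ K.faces)
    (hf : Set.InjOn f.toFun (s : Set V)) (hT : T ⊆ s) :
    oL.rightPart (T.image f.toFun) (s.image f.toFun) = (o.rightPart T s).image f.toFun := by
  unfold VertexOrder.rightPart
  rw [Finset.filter_image]
  congr 1
  refine Finset.filter_congr fun v hv => ?_
  rw [f.below_image hs hf hT hv, f.mem_image_iff hf hT hv]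

/-- Two vertices that are adjacent in the ordering of a simplex lie in a common part. -/
theorem VertexOrder.adjacent_mem_part (o : VertexOrder K) {s T : Finset V} (hT : T ⊆ s) {a b : V}
    (ha : a ∈ s) (hb : b ∈ s) (hadj : ∀ t ∈ s, o.order.lt t b ↔ o.order.le t a) :
    (a ∈ o.leftPart T s ∧ b ∈ o.leftPart T s) ∨ (a ∈ o.rightPart T s ∧ b ∈ o.rightPart T s) := by
  let _ := o.order
  have hbelow : o.below T b = o.below T a + if a ∈ T then 1 else 0 := by
    have h1 : T.filter (fun t => o.order.lt t b) = T.filter (fun t => o.order.le t a) :=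
      Finset.filter_congr fun t ht => hadj t (hT ht)
    unfold VertexOrder.below
    rw [h1]
    split_ifs with haT
    · have h2 : T.filter (fun t => o.order.le t a) =
          insert a (T.filter (fun t => o.order.lt t a)) := by
        ext t
        rw [Finset.mem_insert, Finset.mem_filter, Finset.mem_filter]
        constructor
        · rintro ⟨h, h'⟩
          rcases eq_or_lt_of_le h' with he | hl
          · exact Or.inl he
          · exact Or.inr ⟨h, hl⟩
        · rintro (rfl | ⟨h, h'⟩)
          · exact ⟨haT, le_rfl⟩
          · exact ⟨h, le_of_lt h'⟩
      have h3 : a ∉ T.filter (fun t => o.order.lt t a) := fun h =>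
        lt_irrefl a (Finset.mem_filter.1 h).2
      rw [h2, Finset.card_insert_of_notMem h3]
    · congr 1
      refine Finset.filter_congr fun t ht => ⟨fun h => lt_of_le_of_ne h ?_, fun h => le_of_lt h⟩
      rintro rfl
      exact haT ht
  simp only [o.mem_leftPart, o.mem_rightPart, ha, hb, true_and]
  by_cases haT : a ∈ T
  · simp only [haT, true_or, true_and]
    have := Nat.even_or_odd (o.below T b)
    tauto
  · rw [hbelow, if_neg haT, add_zero]
    have := Nat.even_or_odd (o.below T a)
    tauto

/-- If `a < c` have equal images, the successor `b` of `a` in `s` satisfies `a < b ≤ c`, so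
monotonicity squeezes its image. -/
theorem OrderedMap.exists_adjacent (f : OrderedMap o A oL B) {s : Finset V} (hs : s ∈ K.faces)
    (hf : ¬ Set.InjOn f.toFun (s : Set V)) : ∃ a ∈ s, ∃ b ∈ s, a ≠ b ∧ f.toFun a = f.toFun b ∧
      ∀ t ∈ s, o.order.lt t b ↔ o.order.le t a := by
  let _ := o.order
  have hface : ∀ u ∈ s, ({u} : Finset V) ∈ K.faces := fun u hu =>
    mem_faces_of_subset hs (by simpa using hu) (Finset.singleton_nonempty u)
  obtain ⟨a, ha, c, hc, hac, hfac⟩ :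
      ∃ a ∈ s, ∃ c ∈ s, o.order.lt a c ∧ f.toFun a = f.toFun c := by
    obtain ⟨a, ha, b, hb, hab, hne⟩ : ∃ a ∈ s, ∃ b ∈ s, f.toFun a = f.toFun b ∧ a ≠ b := by
      simpa [Set.InjOn] using hf
    rcases o.lt_or_lt hs ha hb hne with h | h
    · exact ⟨a, ha, b, hb, h, hab⟩
    · exact ⟨b, hb, a, ha, h, hab.symm⟩
  obtain ⟨b, hb⟩ := (s.filter fun w => o.order.lt a w).exists_minimal
    ⟨c, Finset.mem_filter.2 ⟨hc, hac⟩⟩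
  have hb1 := Finset.mem_filter.1 hb.1
  have hmin : ∀ t ∈ s, o.order.lt a t → o.order.le b t := by
    intro t ht hat
    rcases o.total s hs b hb1.1 t ht with h | h
    · exact h
    · exact hb.2 (Finset.mem_filter.2 ⟨ht, hat⟩) h
  refine ⟨a, ha, b, hb1.1, ne_of_lt hb1.2, ?_, fun t ht => ⟨fun h => ?_, fun h => ?_⟩⟩
  · refine oL.order.le_antisymm _ _ (f.mono a b (hface a ha) (hface b hb1.1) (le_of_lt hb1.2)) ?_
    rw [hfac]
    exact f.mono b c (hface b hb1.1) (hface c hc) (hmin c hc hac)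
  · rcases o.total s hs t ht a ha with h' | h'
    · exact h'
    · by_contra hta
      have hat : a < t := lt_of_le_not_ge h' hta
      exact lt_irrefl t (lt_of_lt_of_le h (hmin t ht hat))
  · exact lt_of_le_of_lt h hb1.2

/-- Steenrod's products are natural for order preserving maps. -/
theorem pullback_cup (f : OrderedMap o A oL B) (i : ℤ) {x y : Finset W → ZMod 2}
    (hx : x ∅ = 0) (hy : y ∅ = 0) :
    pullback f (cup oL i x y) = cup o i (pullback f x) (pullback f y) := by
  funext s
  by_cases hs : s ∈ K.faces
  swap
  · simp [pullback, cup, hs]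
  by_cases hf : Set.InjOn f.toFun (s : Set V)
  · have hsub : ∀ (z : Finset W → ZMod 2), z ∅ = 0 → ∀ t ⊆ s,
        pullback f z t = z (t.image f.toFun) := by
      intro z hz t ht
      unfold pullback
      rcases t.eq_empty_or_nonempty with rfl | hne
      · simp [hz]
      · rw [if_pos ⟨mem_faces_of_subset hs ht hne, hf.mono (by exact_mod_cast ht)⟩]
    have himg : s.image f.toFun ∈ L.faces := f.map_faces s hs
    unfold cup
    rw [if_pos hs, pullback, if_pos ⟨hs, hf⟩, if_pos himg]
    symm
    refine Finset.sum_bij (fun T _ => T.image f.toFun) ?_ ?_ ?_ ?_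
    · intro T hT
      rw [Finset.mem_filter, Finset.mem_powerset] at hT ⊢
      exact ⟨Finset.image_subset_image hT.1, by
        rw [Finset.card_image_of_injOn (hf.mono (by exact_mod_cast hT.1)), hT.2]⟩
    · intro T hT T' hT' h
      rw [Finset.mem_filter, Finset.mem_powerset] at hT hT'
      ext v
      by_cases hv : v ∈ s
      · rw [← f.mem_image_iff hf hT.1 hv, ← f.mem_image_iff hf hT'.1 hv, h]
      · exact ⟨fun h => absurd (hT.1 h) hv, fun h => absurd (hT'.1 h) hv⟩
    · intro T' hT'
      rw [Finset.mem_filter, Finset.mem_powerset] at hT'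
      obtain ⟨T, hT, rfl⟩ := Finset.subset_image_iff.1 hT'.1
      have hT : T ⊆ s := by exact_mod_cast hT
      refine ⟨T, Finset.mem_filter.2 ⟨Finset.mem_powerset.2 hT, ?_⟩, rfl⟩
      rw [← hT'.2, Finset.card_image_of_injOn (hf.mono (by exact_mod_cast hT))]
    · intro T hT
      rw [Finset.mem_filter, Finset.mem_powerset] at hT
      rw [hsub x hx _ (o.leftPart_subset T s), hsub y hy _ (o.rightPart_subset T s),
        f.leftPart_image hs hf hT.1, f.rightPart_image hs hf hT.1]
  -- On a degenerate simplex, two adjacent vertices with the same image lie in a common part for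
  -- every cut set, so each term has a factor evaluated on a degenerate face.
  · obtain ⟨a, ha, b, hb, hne, hab, hadj⟩ := f.exists_adjacent hs hf
    have hdeg : ∀ (z : Finset W → ZMod 2) (t : Finset V), a ∈ t → b ∈ t → pullback f z t = 0 :=
      fun z t hat hbt => if_neg fun h => hne (h.2 hat hbt hab)
    rw [hdeg _ s ha hb, cup, if_pos hs, Finset.sum_eq_zero]
    intro T hT
    rw [Finset.mem_filter, Finset.mem_powerset] at hT
    rcases o.adjacent_mem_part hT.1 ha hb hadj with h | h
    · rw [hdeg x _ h.1 h.2, zero_mul]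
    · rw [hdeg y _ h.1 h.2, mul_zero]

end CupProducts

/-! ### The dual maps on cochains and the cochain homotopy. -/

section SubdivisionCochains

variable {V : Type u} (K : PreAbstractSimplicialComplex V)

theorem sum_erase_congr {P M : Type*} [AddCommMonoid M] {F : Finset P} {f g : Finset P → M}
    (h : ∀ G ⊆ F, f G = g G) : ∑ s ∈ F, f (F.erase s) = ∑ s ∈ F, g (F.erase s) :=
  Finset.sum_congr rfl fun s _ => h _ (Finset.erase_subset s F)

/-- The value of a cochain on a chain. -/
noncomputable abbrev evalChain {V : Type u} (c : Finset V → ZMod 2) :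
    (Finset V →₀ ZMod 2) →ₗ[ZMod 2] ZMod 2 :=
  Finsupp.linearCombination (ZMod 2) c

theorem evalChain_single (c : Finset V → ZMod 2) (s : Finset V) :
    evalChain c (Finsupp.single s 1) = c s := by
  simp

theorem evalChain_add (c c' : Finset V → ZMod 2) (x : Finset V →₀ ZMod 2) :
    evalChain (c + c') x = evalChain c x + evalChain c' x := by
  suffices h : evalChain (c + c') = evalChain c + evalChain c' from LinearMap.congr_fun h x
  exact chain_hom_ext fun s => by simp

theorem evalChain_smul (r : ZMod 2) (c : Finset V → ZMod 2) (x : Finset V →₀ ZMod 2) :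
    evalChain (r • c) x = r • evalChain c x := by
  suffices h : evalChain (r • c) = r • evalChain c from LinearMap.congr_fun h x
  exact chain_hom_ext fun s => by simp

theorem evalChain_coboundary (c : Finset V → ZMod 2) {x : Finset V →₀ ZMod 2}
    (hx : x ∈ Finsupp.supported (ZMod 2) (ZMod 2) {s | s ∈ K.faces ∨ s = ∅}) :
    evalChain (coboundary K c) x = evalChain c (chainBoundary V x) := by
  refine map_eq_of_supported (evalChain (coboundary K c)) (evalChain c ∘ₗ chainBoundary V) ?_ hx
  intro s hs
  rw [LinearMap.comp_apply, evalChain_single, chainBoundary_single, map_sum]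
  simp only [evalChain_single]
  rcases hs with hs | rfl
  · simp [coboundary, hs]
  · simp [coboundary, not_empty_mem_faces]

variable {K} in
theorem mem_sd_faces_iff {F : Finset {s : Finset V // s ∈ K.faces}} :
    F ∈ (sd K).faces ↔
      F.Nonempty ∧ IsChain (· ≤ ·) (F : Set {s : Finset V // s ∈ K.faces}) :=
  ⟨fun h => ⟨h.1, h.2.1⟩, fun h => ⟨h.1, h.2, fun s _ => s.2⟩⟩

theorem flagSet_subset_sd (p : {s : Finset V // s ∈ K.faces} → Prop) (k : ℕ) :
    flagSet p k ⊆ {F | F ∈ (sd K).faces ∨ F = ∅} := by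
  intro F hF
  rcases F.eq_empty_or_nonempty with h | h
  · exact Or.inr h
  · exact Or.inl (mem_sd_faces_iff.2 ⟨h, hF.1⟩)

/-- A relative cochain vanishes on chains of simplices that lie below a simplex of `A`. -/
theorem evalChain_eq_zero {A : PreAbstractSimplicialComplex V} {k : ℤ}
    {c : Finset {s : Finset V // s ∈ K.faces} → ZMod 2}
    (hc : c ∈ relCochains (sd K) (sdSub K A) k)
    {p : {s : Finset V // s ∈ K.faces} → Prop} {m : ℕ}
    (hp : (∀ g, p g → g.1 ∈ A.faces) ∨ (m : ℤ) ≠ k + 1)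
    {x : Finset {s : Finset V // s ∈ K.faces} →₀ ZMod 2}
    (hx : x ∈ Finsupp.supported (ZMod 2) (ZMod 2) (flagSet p m)) : evalChain c x = 0 := by
  refine map_eq_of_supported (evalChain c) 0 (fun F hF => ?_) hx
  rw [evalChain_single, LinearMap.zero_apply]
  refine hc F fun h => ?_
  rcases hp with hp | hp
  · exact h.2.1 ⟨h.1.1, hF.1, fun s hs => hp s (hF.2.2 s hs)⟩
  · exact hp (by rw [← hF.2.1]; exact h.2.2)

/-- The map on cochains that is dual to barycentric subdivision. -/
noncomputable def sdCochain :
    (Finset {s : Finset V // s ∈ K.faces} → ZMod 2) →ₗ[ZMod 2] (Finset V → ZMod 2) where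
  toFun c s := if s ∈ K.faces then evalChain c (sdChain K (Finsupp.single s 1)) else 0
  map_add' c c' := by
    funext s
    simp only [Pi.add_apply]
    split_ifs
    · rw [evalChain_add]
    · simp
  map_smul' r c := by
    funext s
    simp only [Pi.smul_apply, RingHom.id_apply]
    split_ifs
    · rw [evalChain_smul]
    · simp

variable {K}

theorem sdCochain_apply {s : Finset V} (hs : s ∈ K.faces)
    (c : Finset {s : Finset V // s ∈ K.faces} → ZMod 2) :
    sdCochain K c s = evalChain c (sdChain K (Finsupp.single s 1)) :=
  if_pos hs

theorem sdCochain_apply_of_notMem {s : Finset V} (hs : s ∉ K.faces)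
    (c : Finset {s : Finset V // s ∈ K.faces} → ZMod 2) : sdCochain K c s = 0 :=
  if_neg hs

variable {A : PreAbstractSimplicialComplex V} {k : ℤ}
  {c : Finset {s : Finset V // s ∈ K.faces} → ZMod 2}

theorem sdCochain_mem (hc : c ∈ relCochains (sd K) (sdSub K A) k) :
    sdCochain K c ∈ relCochains K A k := by
  intro s hs
  by_cases hK : s ∈ K.faces
  swap
  · exact sdCochain_apply_of_notMem hK c
  rw [sdCochain_apply hK]
  refine evalChain_eq_zero K hc ?_ (sdChain_mem_flagSet (Or.inl hK))
  by_cases hA : s ∈ A.faces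
  · exact Or.inl fun g hg => mem_faces_of_subset hA hg (K.isRelLowerSet_faces g.2).1
  · exact Or.inr fun h => hs ⟨hK, hA, h⟩

theorem coboundary_sdCochain (hc : c ∅ = 0) :
    coboundary K (sdCochain K c) = sdCochain K (coboundary (sd K) c) := by
  funext s
  by_cases hs : s ∈ K.faces
  swap
  · rw [sdCochain_apply_of_notMem hs]
    simp [coboundary, hs]
  rw [sdCochain_apply hs, evalChain_coboundary (sd K) c (Finsupp.supported_mono
    (flagSet_subset_sd K _ _) (sdChain_mem_flagSet (Or.inl hs))),
    chainBoundary_sdChain_single (Or.inl hs), chainBoundary_single, map_sum, map_sum]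
  simp only [coboundary, LinearMap.coe_mk, AddHom.coe_mk, if_pos hs]
  refine Finset.sum_congr rfl fun v _ => ?_
  rcases mem_faces_or_empty_of_subset (Or.inl hs) (Finset.erase_subset v s) with h | h
  · exact sdCochain_apply h c
  · rw [h, sdCochain_apply_of_notMem (not_empty_mem_faces K), sdChain_empty, evalChain_single, hc]

variable (o : VertexOrder K)

/-- Pull-back is adjoint to push-forward. The value at `∅` must vanish because the pull-back is zero
there while `∅` pushes forward to `∅`. -/
theorem evalChain_pullback (z : Finset V → ZMod 2) (hz : z ∅ = 0)
    {x : Finset {s : Finset V // s ∈ K.faces} →₀ ZMod 2}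
    (hx : x ∈ Finsupp.supported (ZMod 2) (ZMod 2) {F | F ∈ (sd K).faces ∨ F = ∅}) :
    evalChain (pullback (barycentricMap o A) z) x =
      evalChain z (pushforward o.maxVertex x) := by
  refine map_eq_of_supported _ (evalChain z ∘ₗ pushforward o.maxVertex) ?_ hx
  intro F hF
  rw [LinearMap.comp_apply, evalChain_single, pushforward_single, pullback]
  rcases hF with hF | rfl
  · by_cases hi : Set.InjOn o.maxVertex (F : Set {s : Finset V // s ∈ K.faces})
    · rw [if_pos ⟨hF, hi⟩, if_pos hi, evalChain_single]
      rfl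
    · rw [if_neg (fun h => hi h.2), if_neg hi, map_zero]
  · rw [if_neg (fun h => not_empty_mem_faces _ h.1)]
    simp [hz]

theorem sdCochain_pullback {z : Finset V → ZMod 2} (hz : z ∈ relCochains K A k) :
    sdCochain K (pullback (barycentricMap o A) z) = z := by
  funext s
  by_cases hs : s ∈ K.faces
  swap
  · rw [sdCochain_apply_of_notMem hs, hz s fun h => hs h.1]
  rw [sdCochain_apply hs, evalChain_pullback o z (relCochains_empty hz) (Finsupp.supported_mono
    (flagSet_subset_sd K _ _) (sdChain_mem_flagSet (Or.inl hs))),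
    pushforward_sdChain o (Or.inl hs), evalChain_single]

/-- The composite of the maximum vertex map with subdivision, on chains of the subdivision. -/
noncomputable def sdMax : (Finset {s : Finset V // s ∈ K.faces} →₀ ZMod 2) →ₗ[ZMod 2]
    (Finset {s : Finset V // s ∈ K.faces} →₀ ZMod 2) :=
  sdChain K ∘ₗ pushforward o.maxVertex

theorem pushforward_maxVertex_single {F : Finset {s : Finset V // s ∈ K.faces}}
    (hF : IsChain (· ≤ ·) (F : Set {s : Finset V // s ∈ K.faces})) :
    pushforward o.maxVertex (Finsupp.single F 1) = 0 ∨ ∃ s, (s ∈ K.faces ∨ s = ∅) ∧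
      s.card = F.card ∧ (∀ v ∈ s, ∃ g ∈ F, o.maxVertex g = v) ∧
      pushforward o.maxVertex (Finsupp.single F 1) = Finsupp.single s 1 := by
  rw [pushforward_single]
  split_ifs with h
  · refine Or.inr ⟨F.image o.maxVertex, ?_, Finset.card_image_of_injOn h, ?_, rfl⟩
    · rcases F.eq_empty_or_nonempty with rfl | hne
      · exact Or.inr rfl
      · exact Or.inl (o.image_maxVertex_mem K F (mem_sd_faces_iff.2 ⟨hne, hF⟩))
    · intro v hv
      exact Finset.mem_image.1 hv
  · exact Or.inl rfl

theorem chainBoundary_sdMax {F : Finset {s : Finset V // s ∈ K.faces}}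
    (hF : IsChain (· ≤ ·) (F : Set {s : Finset V // s ∈ K.faces})) :
    chainBoundary _ (sdMax o (Finsupp.single F 1)) =
      sdMax o (chainBoundary _ (Finsupp.single F 1)) := by
  simp only [sdMax, LinearMap.comp_apply, pushforward_chainBoundary]
  rcases pushforward_maxVertex_single o hF with h | ⟨s, hs, -, -, h⟩
  · rw [h, map_zero, map_zero, map_zero, map_zero]
  · rw [h, chainBoundary_sdChain_single hs]

/-- The maximum vertices of the members of `F` all lie in its top, so subdividing their span
produces faces of that top. This is the carrier condition for the homotopy. -/
theorem sdMax_mem_flagSet {F : Finset {s : Finset V // s ∈ K.faces}}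
    (hF : IsChain (· ≤ ·) (F : Set {s : Finset V // s ∈ K.faces})) :
    sdMax o (Finsupp.single F 1) ∈
      Finsupp.supported (ZMod 2) (ZMod 2) (flagSet (fun g => ∃ s ∈ F, g ≤ s) F.card) := by
  simp only [sdMax, LinearMap.comp_apply]
  rcases pushforward_maxVertex_single o hF with h | ⟨s, hs, hcard, himg, h⟩
  · rw [h, map_zero]
    exact Submodule.zero_mem _
  · rw [h, ← hcard]
    refine Finsupp.supported_mono (flagSet_mono (fun g hg => ?_) _) (sdChain_mem_flagSet hs)
    rcases F.eq_empty_or_nonempty with rfl | hne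
    · obtain ⟨v, hv⟩ := (K.isRelLowerSet_faces g.2).1
      obtain ⟨g', hg', -⟩ := himg v (hg hv)
      exact absurd hg' (by simp)
    · obtain ⟨t, ht, htop⟩ := exists_top_of_isChain hF hne
      refine ⟨t, ht, fun v hv => ?_⟩
      obtain ⟨r, hr, rfl⟩ := himg v (hg hv)
      exact htop r hr (o.maxVertex_mem r)

/-- The cochain homotopy between the identity and `b^* ∘ sd^*`. -/
noncomputable def sdHomotopy : (Finset {s : Finset V // s ∈ K.faces} → ZMod 2) →ₗ[ZMod 2]
    (Finset {s : Finset V // s ∈ K.faces} → ZMod 2) where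
  toFun c F := if F ∈ (sd K).faces then
    evalChain c (coneHomotopy (sdMax o) (Finsupp.single F 1)) else 0
  map_add' c c' := by
    funext s
    simp only [Pi.add_apply]
    split_ifs
    · rw [evalChain_add]
    · simp
  map_smul' r c := by
    funext s
    simp only [Pi.smul_apply, RingHom.id_apply]
    split_ifs
    · rw [evalChain_smul]
    · simp

theorem sdHomotopy_apply {F : Finset {s : Finset V // s ∈ K.faces}} (hF : F ∈ (sd K).faces)
    (c : Finset {s : Finset V // s ∈ K.faces} → ZMod 2) :
    sdHomotopy o c F = evalChain c (coneHomotopy (sdMax o) (Finsupp.single F 1)) :=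
  if_pos hF

theorem sdHomotopy_apply_of_notMem {F : Finset {s : Finset V // s ∈ K.faces}}
    (hF : F ∉ (sd K).faces) (c : Finset {s : Finset V // s ∈ K.faces} → ZMod 2) :
    sdHomotopy o c F = 0 :=
  if_neg hF

theorem sdHomotopy_mem (hc : c ∈ relCochains (sd K) (sdSub K A) k) :
    sdHomotopy o c ∈ relCochains (sd K) (sdSub K A) (k - 1) := by
  intro F hF
  by_cases hK : F ∈ (sd K).faces
  swap
  · exact sdHomotopy_apply_of_notMem o hK c
  rw [sdHomotopy_apply o hK]
  refine evalChain_eq_zero K hc ?_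
    (coneHomotopy_mem_flagSet (sdMax o) (fun G hG => sdMax_mem_flagSet o hG) F hK.2.1)
  by_cases hA : F ∈ (sdSub K A).faces
  · left
    rintro g ⟨s, hs, hg⟩
    exact mem_faces_of_subset (hA.2.2 s hs) hg (K.isRelLowerSet_faces g.2).1
  · right
    intro h
    push_cast at h
    exact hF ⟨hK, hA, by omega⟩

/-- This is `chainBoundary_coneHomotopy` for `sdMax`, evaluated by `c`; precomposition with `∂` and
with the homotopy becomes `coboundary` and `sdHomotopy`. -/
theorem pullback_sdCochain (hc : c ∈ relCochains (sd K) (sdSub K A) k) :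
    pullback (barycentricMap o A) (sdCochain K c) =
      c + coboundary (sd K) (sdHomotopy o c) + sdHomotopy o (coboundary (sd K) c) := by
  funext F
  simp only [Pi.add_apply]
  by_cases hF : F ∈ (sd K).faces
  swap
  · rw [sdHomotopy_apply_of_notMem o hF, hc F fun h => hF h.1]
    simp [pullback, coboundary, hF]
  have h1 : pullback (barycentricMap o A) (sdCochain K c) F =
      evalChain c (sdMax o (Finsupp.single F 1)) := by
    have hFs : Finsupp.single F (1 : ZMod 2) ∈
        Finsupp.supported (ZMod 2) (ZMod 2) {F | F ∈ (sd K).faces ∨ F = ∅} :=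
      Finsupp.single_mem_supported _ _ (Or.inl hF)
    have h2 := evalChain_pullback (A := A) o (sdCochain K c)
      (sdCochain_apply_of_notMem (not_empty_mem_faces K) c) hFs
    rw [evalChain_single] at h2
    rw [h2, sdMax, LinearMap.comp_apply]
    rcases pushforward_maxVertex_single o hF.2.1 with h | ⟨s, hs, hcard, -, h⟩
    · rw [h, map_zero, map_zero, map_zero]
    · rw [h, evalChain_single]
      refine sdCochain_apply (hs.resolve_right ?_) c
      rintro rfl
      have := Finset.card_pos.2 hF.1
      simp at hcard
      omega
  have h2 : coboundary (sd K) (sdHomotopy o c) F =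
      evalChain c (coneHomotopy (sdMax o) (chainBoundary _ (Finsupp.single F 1))) := by
    have hsub : ∀ G ⊆ F, sdHomotopy o c G =
        evalChain c (coneHomotopy (sdMax o) (Finsupp.single G 1)) := by
      intro G hG
      rcases mem_faces_or_empty_of_subset (Or.inl hF) hG with h | rfl
      · exact sdHomotopy_apply o h c
      · rw [sdHomotopy_apply_of_notMem o (not_empty_mem_faces _), coneHomotopy_empty, map_zero]
    rw [chainBoundary_single, map_sum, map_sum]
    simp only [coboundary, LinearMap.coe_mk, AddHom.coe_mk, if_pos hF]
    exact sum_erase_congr hsub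
  have h3 : sdHomotopy o (coboundary (sd K) c) F =
      evalChain c (chainBoundary _ (coneHomotopy (sdMax o) (Finsupp.single F 1))) := by
    rw [sdHomotopy_apply o hF, evalChain_coboundary (sd K) c (Finsupp.supported_mono
      (flagSet_subset_sd K _ _)
      (coneHomotopy_mem_flagSet (sdMax o) (fun G hG => sdMax_mem_flagSet o hG) F hF.2.1))]
  have key := congrArg (evalChain c) (chainBoundary_coneHomotopy (sdMax o)
    (by simp [sdMax, pushforward_single, sdChain_empty])
    (fun G hG => chainBoundary_sdMax o hG) F hF.2.1)
  rw [map_add, map_add, evalChain_single] at key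
  rw [h1, h2, h3]
  have hd := CharTwo.add_self_eq_zero (c F)
  linear_combination -key - hd

end SubdivisionCochains

/-! ### Integration over the subdivision. -/

section Integrals

variable {V : Type u} {K : PreAbstractSimplicialComplex V}

theorem integral_eq_sum {n : ℕ} (hK : K.faces.Finite) (w : Finset V → ZMod 2) :
    integral K n w = ∑ s ∈ hK.toFinset.filter (fun s => s.card = n + 1), w s := by
  unfold integral
  refine finsum_mem_eq_sum_of_inter_support_eq _ ?_
  congr 1
  ext s
  simp

theorem integral_add {n : ℕ} (hK : K.faces.Finite) (w w' : Finset V → ZMod 2) :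
    integral K n (w + w') = integral K n w + integral K n w' := by
  simp only [integral_eq_sum hK, Pi.add_apply, Finset.sum_add_distrib]

theorem integral_zero (n : ℕ) : integral K n 0 = 0 := by
  simp [integral]

theorem finite_sd_faces (hK : K.faces.Finite) : (sd K).faces.Finite := by
  have : Finite {s : Finset V // s ∈ K.faces} := hK.to_subtype
  exact Set.toFinite _

/-- The fundamental chain of the subdivision is the subdivision of the fundamental chain. -/
theorem integral_sd {n : ℕ} (hK : K.faces.Finite) (hdim : ∀ s ∈ K.faces, s.card ≤ n + 1)
    (x : Finset {s : Finset V // s ∈ K.faces} → ZMod 2) :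
    integral (sd K) n x = integral K n (sdCochain K x) := by
  rw [integral_eq_sum (finite_sd_faces hK), integral_eq_sum hK]
  have h1 : ∀ s ∈ hK.toFinset.filter (fun s => s.card = n + 1), sdCochain K x s =
      ∑ F ∈ (finite_sd_faces hK).toFinset.filter (fun F => F.card = n + 1),
        sdChain K (Finsupp.single s 1) F • x F := by
    intro s hs
    rw [Finset.mem_filter, Set.Finite.mem_toFinset] at hs
    rw [sdCochain_apply hs.1, Finsupp.linearCombination_apply]
    refine Finsupp.sum_of_support_subset _ (fun F hF => ?_) _ fun F _ => zero_smul _ _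
    have := (Finsupp.mem_supported _ _).1 (sdChain_mem_flagSet (Or.inl hs.1)) hF
    rw [Finset.mem_filter, Set.Finite.mem_toFinset]
    refine ⟨mem_sd_faces_iff.2 ⟨Finset.card_pos.1 ?_, this.1⟩, this.2.1.trans hs.2⟩
    rw [this.2.1, hs.2]
    exact Nat.succ_pos n
  rw [Finset.sum_congr rfl h1, Finset.sum_comm]
  refine Finset.sum_congr rfl fun F hF => ?_
  rw [Finset.mem_filter, Set.Finite.mem_toFinset] at hF
  rw [← Finset.sum_smul]
  -- By the dimension bound, the top of a flag with `n + 1` members is an `n`-simplex `t`. No other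
  -- `n`-simplex contains it, so the flag is counted once.
  obtain ⟨t, ht, htop⟩ := exists_top_of_isChain hF.1.2.1 hF.1.1
  have htcard : t.1.card = n + 1 := le_antisymm (hdim t.1 t.2)
    (hF.2 ▸ card_le_card_of_isChain hF.1.2.1 htop)
  have h2 : ∀ s ∈ hK.toFinset.filter (fun s => s.card = n + 1),
      sdChain K (Finsupp.single s 1) F = if ∀ g ∈ F, g.1 ⊆ s then 1 else 0 := by
    intro s hs
    rw [Finset.mem_filter, Set.Finite.mem_toFinset] at hs
    exact sdChain_apply (Or.inl hs.1) hF.1.2.1 (hF.2.trans hs.2.symm)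
  rw [Finset.sum_congr rfl h2, Finset.sum_eq_single_of_mem t.1, if_pos (by exact htop), one_smul]
  · rw [Finset.mem_filter, Set.Finite.mem_toFinset]
    exact ⟨t.2, htcard⟩
  · intro s hs hne
    rw [Finset.mem_filter] at hs
    refine if_neg fun h => hne ?_
    exact (Finset.eq_of_subset_of_card_le (h t ht) (by rw [htcard, hs.2])).symm

end Integrals

/-! ### Consequences of the link conditions: dimension and Stokes' theorem. -/

section Manifolds

variable {V : Type u} {K A : PreAbstractSimplicialComplex V} {n : ℕ}

theorem augChains_eq_bot {X : PreAbstractSimplicialComplex V} {k : ℤ}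
    (h : ∀ s, (s ∈ X.faces ∨ s = ∅) → (s.card : ℤ) ≠ k + 1) : augChains X k = ⊥ := by
  have he : {s : Finset V | (s ∈ X.faces ∨ s = ∅) ∧ (s.card : ℤ) = k + 1} = ∅ := by
    ext s
    simp only [Set.mem_ofPred_eq, Set.mem_empty_iff_false, iff_false]
    exact fun hs => h s hs.1 hs.2
  rw [augChains, he, Finsupp.supported_empty]

/-- Otherwise the link would have nonzero homology in a degree below `-1`, where there are no
augmented chains. -/
theorem card_le_of_notMem (hM : IsTriangulatedManifold K A n) {s : Finset V} (hs : s ∈ K.faces)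
    (hA : s ∉ A.faces) : s.card ≤ n + 1 := by
  by_contra hlt
  obtain ⟨e⟩ := (hM.link_interior s hs hA).1
  have h1 : augChains (link K s) ((n : ℤ) - s.card) = ⊥ := augChains_eq_bot fun t _ => by omega
  have h2 : Subsingleton (augCycles (link K s) ((n : ℤ) - s.card)) := by
    rw [augCycles, h1, bot_inf_eq]
    infer_instance
  have h3 : Subsingleton (ReducedHomology (link K s) ((n : ℤ) - s.card)) :=
    (Submodule.mkQ_surjective _).subsingleton
  have h4 : Subsingleton (ZMod 2) := e.symm.toEquiv.subsingleton
  exact one_ne_zero (Subsingleton.elim (1 : ZMod 2) 0)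

/-- The link of a maximal simplex is empty, and the class of `∅` in degree `-1` shows that the empty
complex is not acyclic. The dimension bound for boundary simplices follows by enlarging them to
maximal ones. -/
theorem notMem_boundary_of_maximal (hM : IsTriangulatedManifold K A n) {s : Finset V}
    (hmax : ∀ t ∈ K.faces, s ⊆ t → t = s) : s ∉ A.faces := by
  intro hA
  have hlink : ∀ t, t ∉ (link K s).faces := by
    rintro t ⟨hne, hdisj, hK⟩
    have h := hmax _ hK Finset.subset_union_right
    obtain ⟨v, hv⟩ := hne
    exact Finset.disjoint_left.1 hdisj hv (h ▸ Finset.mem_union_left s hv)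
  have h0 : Finsupp.single ∅ 1 ∈ augCycles (link K s) (-1) := by
    refine ⟨Finsupp.single_mem_supported _ _ ⟨Or.inr rfl, by simp⟩, ?_⟩
    rw [SetLike.mem_coe, LinearMap.mem_ker, chainBoundary_single, Finset.sum_empty]
  have h1 : augChains (link K s) (-1 + 1) = ⊥ := by
    refine augChains_eq_bot fun t ht => ?_
    rw [ht.resolve_left (hlink t)]
    simp
  have h2 := @Subsingleton.elim _ (hM.link_boundary s hA (-1))
    (Submodule.Quotient.mk ⟨Finsupp.single ∅ 1, h0⟩) 0
  rw [Submodule.Quotient.mk_eq_zero, h1, Submodule.map_bot, Submodule.mem_comap,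
    Submodule.mem_bot] at h2
  exact one_ne_zero (Finsupp.single_eq_zero.1 h2)

/-- The simplices of an `n`-manifold have dimension at most `n`. -/
theorem card_le (hM : IsTriangulatedManifold K A n) {s : Finset V} (hs : s ∈ K.faces) :
    s.card ≤ n + 1 := by
  obtain ⟨t, hst, ht⟩ := hM.finite.exists_le_maximal hs
  have hmax : ∀ r ∈ K.faces, t ⊆ r → r = t := fun r hr htr =>
    Finset.Subset.antisymm (ht.2 hr htr) htr
  exact (Finset.card_le_card hst).trans
    (card_le_of_notMem hM ht.1 (notMem_boundary_of_maximal hM hmax))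

/-- An interior simplex of codimension one lies in an even number of top simplices. -/
theorem even_card_cofaces (hM : IsTriangulatedManifold K A n) {r : Finset V} (hr : r ∈ K.faces)
    (hA : r ∉ A.faces) (hcard : r.card = n) {S : Finset V}
    (hS : ∀ v, v ∈ S ↔ v ∉ r ∧ insert v r ∈ K.faces) : Even S.card := by
  have hsphere := (hM.link_interior r hr hA).1
  rw [hcard, sub_self] at hsphere
  obtain ⟨e⟩ := hsphere
  have hlink : ∀ v, {v} ∈ (link K r).faces ↔ v ∈ S := by
    intro v
    rw [hS]
    change ({v} : Finset V).Nonempty ∧ Disjoint {v} r ∧ {v} ∪ r ∈ K.faces ↔ _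
    rw [Finset.disjoint_singleton_left, Finset.insert_eq]
    simp
  -- An edge in the link would give a simplex with `n + 2` vertices. Without boundaries, the degree
  -- 0 cycles of the link inject into a group of order two.
  have hchain : augChains (link K r) (0 + 1) = ⊥ := by
    refine augChains_eq_bot fun t ht h => ?_
    rcases ht with ⟨-, hdisj, hK⟩ | rfl
    · have h1 := card_le hM hK
      rw [Finset.card_union_of_disjoint hdisj] at h1
      omega
    · simp at h
  have hinj : ∀ x y : augCycles (link K r) 0,
      (Submodule.Quotient.mk x : ReducedHomology (link K r) 0) = Submodule.Quotient.mk y →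
        x = y := by
    intro x y h
    rw [Submodule.Quotient.eq, hchain, Submodule.map_bot, Submodule.mem_comap,
      Submodule.mem_bot] at h
    exact sub_eq_zero.1 (Subtype.ext h)
  have hpigeon : ∀ x y z : augCycles (link K r) 0, x = y ∨ y = z ∨ x = z := by
    intro x y z
    have h : ∀ a b c : ZMod 2, a = b ∨ b = c ∨ a = c := by decide
    rcases h (e (Submodule.Quotient.mk x)) (e (Submodule.Quotient.mk y))
      (e (Submodule.Quotient.mk z)) with h | h | h
    · exact Or.inl (hinj _ _ (e.injective h))
    · exact Or.inr (Or.inl (hinj _ _ (e.injective h)))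
    · exact Or.inr (Or.inr (hinj _ _ (e.injective h)))
  have hbdry : ∀ v : V, chainBoundary V (Finsupp.single {v} 1) = Finsupp.single ∅ 1 := by
    intro v
    rw [chainBoundary_single, Finset.sum_singleton, Finset.erase_singleton]
  have hcycle : ∀ v ∈ S, ∀ w ∈ S, Finsupp.single {v} (1 : ZMod 2) + Finsupp.single {w} 1 ∈
      augCycles (link K r) 0 := by
    intro v hv w hw
    refine ⟨Submodule.add_mem _ ?_ ?_, ?_⟩
    · exact Finsupp.single_mem_supported _ _ ⟨Or.inl ((hlink v).2 hv), by simp⟩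
    · exact Finsupp.single_mem_supported _ _ ⟨Or.inl ((hlink w).2 hw), by simp⟩
    · rw [SetLike.mem_coe, LinearMap.mem_ker, map_add, hbdry, hbdry, chain_add_self]
  have hne1 : S.card ≠ 1 := by
    intro h
    obtain ⟨v, rfl⟩ := Finset.card_eq_one.1 h
    -- With a single vertex the augmentation is injective on degree 0 chains, so the homology would
    -- vanish.
    have hzero : ∀ x ∈ augCycles (link K r) 0, x = 0 := by
      rintro x ⟨hx1, hx2⟩
      have hx : x = Finsupp.single {v} (x {v}) := by
        refine map_eq_of_supported LinearMap.id
          (Finsupp.lsingle {v} ∘ₗ Finsupp.lapply ({v} : Finset V)) ?_ hx1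
        rintro s ⟨hs, hsc⟩
        obtain ⟨w, rfl⟩ := Finset.card_eq_one.1 (by exact_mod_cast hsc.trans (zero_add 1))
        have hw := (hlink w).1 (hs.resolve_right (Finset.singleton_ne_empty w))
        rw [Finset.mem_singleton.1 hw]
        simp
      have hx3 : x {v} • chainBoundary V (Finsupp.single {v} 1) = 0 := by
        rw [← map_smul, Finsupp.smul_single, smul_eq_mul, mul_one, ← hx]
        exact hx2
      rw [hbdry, Finsupp.smul_single, smul_eq_mul, mul_one, Finsupp.single_eq_zero] at hx3
      rw [hx, hx3, Finsupp.single_zero]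
    have h2 : Subsingleton (augCycles (link K r) 0) :=
      ⟨fun x y => Subtype.ext ((hzero _ x.2).trans (hzero _ y.2).symm)⟩
    have h3 : Subsingleton (ReducedHomology (link K r) 0) :=
      (Submodule.mkQ_surjective _).subsingleton
    have h4 : Subsingleton (ZMod 2) := e.symm.toEquiv.subsingleton
    exact one_ne_zero (Subsingleton.elim (1 : ZMod 2) 0)
  have hle : S.card ≤ 2 := by
    by_contra hlt
    obtain ⟨a, b, c, ha, hb, hc, hab, hac, hbc⟩ := Finset.two_lt_card_iff.1 (not_le.1 hlt)
    -- Three vertices would give three distinct cycles `0`, `a + b`, `a + c`.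
    rcases hpigeon 0 ⟨_, hcycle a ha b hb⟩ ⟨_, hcycle a ha c hc⟩ with h | h | h
    · have := DFunLike.congr_fun (congrArg Subtype.val h) {a}
      simp [hab.symm] at this
    · have := DFunLike.congr_fun (congrArg Subtype.val h) {b}
      simp [hab, hbc.symm] at this
    · have := DFunLike.congr_fun (congrArg Subtype.val h) {a}
      simp [hac.symm] at this
  have h02 : S.card = 0 ∨ S.card = 2 := by omega
  rcases h02 with h | h <;> rw [h] <;> decide

/-- Stokes' theorem: relative coboundaries integrate to zero. -/
theorem integral_coboundary (hM : IsTriangulatedManifold K A n) {w : Finset V → ZMod 2}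
    (hw : w ∈ relCochains K A ((n : ℤ) - 1)) : integral K n (coboundary K w) = 0 := by
  have hcob : ∀ s ∈ hM.finite.toFinset.filter (fun s => s.card = n + 1),
      coboundary K w s = ∑ v ∈ s, w (s.erase v) := by
    intro s hs
    rw [Finset.mem_filter, Set.Finite.mem_toFinset] at hs
    exact if_pos hs.1
  let cofaces : Finset V → Finset V := fun r =>
    (hM.finite.toFinset.biUnion id).filter fun v => v ∉ r ∧ insert v r ∈ K.faces
  have hcofaces : ∀ r v, v ∈ cofaces r ↔ v ∉ r ∧ insert v r ∈ K.faces := by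
    intro r v
    rw [Finset.mem_filter, and_iff_right_iff_imp]
    intro h
    exact Finset.mem_biUnion.2 ⟨insert v r, (Set.Finite.mem_toFinset _).2 h.2,
      Finset.mem_insert_self v r⟩
  -- Summation is exchanged between top simplices and their facets. For `n = 0` the facet is `∅`,
  -- which is not in `K.faces` and has to be added.
  have hswap : ∑ s ∈ hM.finite.toFinset.filter (fun s => s.card = n + 1),
      ∑ v ∈ s, w (s.erase v) =
      ∑ r ∈ (insert ∅ hM.finite.toFinset).filter (fun r => r.card = n),
        ∑ _v ∈ cofaces r, w r := by
    rw [Finset.sum_sigma', Finset.sum_sigma']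
    refine Finset.sum_bij' (fun a _ => ⟨a.1.erase a.2, a.2⟩) (fun a _ => ⟨insert a.2 a.1, a.2⟩)
      ?_ ?_ ?_ ?_ ?_
    · rintro ⟨s, v⟩ h
      simp only [Finset.mem_sigma, Finset.mem_filter, Set.Finite.mem_toFinset,
        Finset.mem_insert, hcofaces] at h ⊢
      refine ⟨⟨?_, ?_⟩, Finset.notMem_erase v s, ?_⟩
      · exact (mem_faces_or_empty_of_subset (Or.inl h.1.1) (Finset.erase_subset v s)).symm
      · rw [Finset.card_erase_of_mem h.2, h.1.2]; rfl
      · rw [Finset.insert_erase h.2]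
        exact h.1.1
    · rintro ⟨r, v⟩ h
      simp only [Finset.mem_sigma, Finset.mem_filter, Set.Finite.mem_toFinset,
        Finset.mem_insert, hcofaces] at h ⊢
      exact ⟨⟨h.2.2, by rw [Finset.card_insert_of_notMem h.2.1, h.1.2]⟩, Or.inl trivial⟩
    · rintro ⟨s, v⟩ h
      simp only [Finset.mem_sigma] at h
      simp [Finset.insert_erase h.2]
    · rintro ⟨r, v⟩ h
      simp only [Finset.mem_sigma, hcofaces] at h
      simp [Finset.erase_insert h.2.1]
    · rintro ⟨s, v⟩ _
      rfl
  rw [integral_eq_sum hM.finite, Finset.sum_congr rfl hcob, hswap]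
  refine Finset.sum_eq_zero fun r hr => ?_
  rw [Finset.sum_const]
  by_cases h : r ∈ K.faces ∧ r ∉ A.faces
  · have he := even_card_cofaces hM h.1 h.2 (Finset.mem_filter.1 hr).2 (hcofaces r)
    rw [nsmul_eq_mul, (ZMod.natCast_eq_zero_iff_even).2 he, zero_mul]
  · rw [hw r fun h' => h ⟨h'.1, h'.2.1⟩, smul_zero]

/-- Stokes is transported along `sdCochain`, so there is no need to show that the subdivision is a
homology manifold. -/
theorem integral_sd_coboundary (hM : IsTriangulatedManifold K A n)
    {w : Finset {s : Finset V // s ∈ K.faces} → ZMod 2}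
    (hw : w ∈ relCochains (sd K) (sdSub K A) ((n : ℤ) - 1)) :
    integral (sd K) n (coboundary (sd K) w) = 0 := by
  rw [integral_sd hM.finite (fun s hs => card_le hM hs),
    ← coboundary_sdCochain (relCochains_empty hw), integral_coboundary hM (sdCochain_mem hw)]

theorem integral_pullback (hM : IsTriangulatedManifold K A n) (o : VertexOrder K)
    {k : ℤ} {w : Finset V → ZMod 2} (hw : w ∈ relCochains K A k) :
    integral (sd K) n (pullback (barycentricMap o A) w) = integral K n w := by
  rw [integral_sd hM.finite (fun s hs => card_le hM hs), sdCochain_pullback o hw]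

end Manifolds

/-! ### Integral identities from Steenrod's formula and Stokes. -/

section ProductIntegrals

variable {V : Type u} {K A : PreAbstractSimplicialComplex V} {n : ℕ} (o : VertexOrder K)

/-- Stokes for `p ∪_{n-1} q`, whose coboundary is the commutator of `∪_{n-2}` on cocycles. -/
theorem integral_cup_comm (hK : K.faces.Finite)
    (hstokes : ∀ w ∈ relCochains K A ((n : ℤ) - 1), integral K n (coboundary K w) = 0)
    {p q : Finset V → ZMod 2} (hp : p ∈ relCocycles K A ((n : ℤ) - 1))
    (hq : q ∈ relCocycles K A ((n : ℤ) - 1)) :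
    integral K n (cup o ((n : ℤ) - 2) p q) = integral K n (cup o ((n : ℤ) - 2) q p) := by
  have h1 := hstokes _ (by simpa using cup_mem o (i := (n : ℤ) - 1) hp.1 hq.1)
  have hdp : coboundary K p = 0 := hp.2
  have hdq : coboundary K q = 0 := hq.2
  rw [coboundary_cup o _ p q (relCochains_empty hp.1), hdp, hdq, cup_zero_left, cup_zero_right,
    add_zero, zero_add, integral_add hK, show (n : ℤ) - 1 - 1 = n - 2 by ring] at h1
  exact CharTwo.add_eq_zero.1 h1

/-- The cross terms are `c ∪_{n-4} e + e ∪_{n-4} c + c ∪_{n-3} de + e ∪_{n-3} dc`. Adding `d(c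
∪_{n-3} e)` and `d(dc ∪_{n-2} e)` turns them into `dc ∪_{n-2} de`. -/
theorem integral_sq_add (hK : K.faces.Finite)
    (hstokes : ∀ w ∈ relCochains K A ((n : ℤ) - 1), integral K n (coboundary K w) = 0)
    {c e : Finset V → ZMod 2} (hc : c ∈ relCochains K A ((n : ℤ) - 2))
    (he : e ∈ relCochains K A ((n : ℤ) - 2)) :
    integral K n (sq o 2 ((n : ℤ) - 2) (c + e)) =
      integral K n (sq o 2 ((n : ℤ) - 2) c) + integral K n (sq o 2 ((n : ℤ) - 2) e) +
        integral K n (cup o ((n : ℤ) - 2) (coboundary K c) (coboundary K e)) := by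
  have hdc := coboundary_mem hc
  have h1 := hstokes (cup o ((n : ℤ) - 2 - 2 + 1) c e) (by
    have := cup_mem o (i := (n : ℤ) - 2 - 2 + 1) hc he
    rwa [show (n : ℤ) - 2 + (n - 2) - (n - 2 - 2 + 1) = n - 1 by ring] at this)
  have h2 := hstokes (cup o ((n : ℤ) - 2) (coboundary K c) e) (by
    have := cup_mem o (i := (n : ℤ) - 2) hdc he
    rwa [show (n : ℤ) - 2 + 1 + (n - 2) - (n - 2) = n - 1 by ring] at this)
  rw [coboundary_cup o _ _ _ (relCochains_empty hc), add_sub_cancel_right] at h1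
  rw [coboundary_cup o _ _ _ (relCochains_empty hdc), coboundary_coboundary, cup_zero_left,
    zero_add, show (n : ℤ) - 2 - 1 = n - 2 - 2 + 1 by ring] at h2
  simp only [sq, map_add, cup_add_left, cup_add_right, integral_add hK] at h1 h2 ⊢
  have h3 := CharTwo.add_self_eq_zero
    (integral K n (cup o ((n : ℤ) - 2) (coboundary K c) (coboundary K e)))
  have h4 := CharTwo.add_self_eq_zero
    (integral K n (cup o ((n : ℤ) - 2 - 2 + 1) (coboundary K c) e))
  linear_combination h1 + h2 - h3 - h4

/-- Here `Sq²(df) = df ∪_{n-4} df`, which equals `d(f ∪_{n-4} df) + d(f ∪_{n-5} f)` modulo 2. -/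
theorem integral_sq_coboundary (hK : K.faces.Finite)
    (hstokes : ∀ w ∈ relCochains K A ((n : ℤ) - 1), integral K n (coboundary K w) = 0)
    {f : Finset V → ZMod 2} (hf : f ∈ relCochains K A ((n : ℤ) - 2 - 1)) :
    integral K n (sq o 2 ((n : ℤ) - 2) (coboundary K f)) = 0 := by
  have hdf := coboundary_mem hf
  have h1 := hstokes (cup o ((n : ℤ) - 2 - 2) f (coboundary K f)) (by
    have := cup_mem o (i := (n : ℤ) - 2 - 2) hf hdf
    rwa [show (n : ℤ) - 2 - 1 + (n - 2 - 1 + 1) - (n - 2 - 2) = n - 1 by ring] at this)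
  have h2 := hstokes (cup o ((n : ℤ) - 2 - 2 - 1) f f) (by
    have := cup_mem o (i := (n : ℤ) - 2 - 2 - 1) hf hf
    rwa [show (n : ℤ) - 2 - 1 + (n - 2 - 1) - (n - 2 - 2 - 1) = n - 1 by ring] at this)
  rw [coboundary_cup o _ _ _ (relCochains_empty hf), coboundary_coboundary, cup_zero_right,
    add_zero] at h1
  rw [coboundary_cup o _ _ _ (relCochains_empty hf)] at h2
  simp only [sq, coboundary_coboundary, cup_zero_right, add_zero, integral_add hK] at h1 h2 ⊢
  have h3 := CharTwo.add_self_eq_zero (integral K n (cup o ((n : ℤ) - 2 - 2 - 1 - 1) f f))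
  have h4 := CharTwo.add_self_eq_zero
    (integral K n (cup o ((n : ℤ) - 2 - 2 - 1) f (coboundary K f)))
  have h5 := CharTwo.add_self_eq_zero
    (integral K n (cup o ((n : ℤ) - 2 - 2 - 1) (coboundary K f) f))
  linear_combination h1 + h2 - h3 - h4 - h5

end ProductIntegrals

/-! ### Restriction and extension of quadratic functions. -/

section Main

variable {V : Type u} {K A : PreAbstractSimplicialComplex V} {n : ℕ}

theorem pullback_add {W : Type v} {L B : PreAbstractSimplicialComplex W} {oK : VertexOrder K}
    {oL : VertexOrder L} (f : OrderedMap oK A oL B) (x y : Finset W → ZMod 2) :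
    pullback f (x + y) = pullback f x + pullback f y := by
  funext s
  simp only [pullback, Pi.add_apply]
  split_ifs <;> simp

theorem integral_cup_pullback (hM : IsTriangulatedManifold K A n) (o : VertexOrder K) {i k l : ℤ}
    {x y : Finset V → ZMod 2} (hx : x ∈ relCochains K A k) (hy : y ∈ relCochains K A l) :
    integral (sd K) n (cup (sdOrder K) i (pullback (barycentricMap o A) x)
      (pullback (barycentricMap o A) y)) = integral K n (cup o i x y) := by
  rw [← pullback_cup _ _ (relCochains_empty hx) (relCochains_empty hy),
    integral_pullback hM o (cup_mem o hx hy)]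

theorem integral_sq_pullback (hM : IsTriangulatedManifold K A n) (o : VertexOrder K) {j k l : ℤ}
    {c : Finset V → ZMod 2} (hc : c ∈ relCochains K A l) :
    integral (sd K) n (sq (sdOrder K) j k (pullback (barycentricMap o A) c)) =
      integral K n (sq o j k c) := by
  rw [sq, sq, integral_add hM.finite, integral_add (finite_sd_faces hM.finite),
    pullback_coboundary _ hc, integral_cup_pullback hM o hc hc,
    integral_cup_pullback hM o hc (coboundary_mem hc)]

/-- The coboundary of a cochain, as a cocycle. -/
noncomputable def coboundaryCocycle {k : ℤ} (c : Finset V → ZMod 2)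
    (hc : c ∈ relCochains K A (k - 1)) : relCocycles K A k :=
  ⟨coboundary K c, by simpa using coboundary_mem hc, coboundary_coboundary c⟩

/-- The map on cocycles that is dual to barycentric subdivision. -/
noncomputable def sdCocycle {k : ℤ} (p : relCocycles (sd K) (sdSub K A) k) : relCocycles K A k :=
  ⟨sdCochain K p.1, sdCochain_mem p.2.1, by
    have h : coboundary (sd K) p.1 = 0 := p.2.2
    change coboundary K (sdCochain K p.1) = 0
    rw [coboundary_sdCochain (relCochains_empty p.2.1), h, map_zero]⟩

theorem eq_pullback_add_coboundary (o : VertexOrder K) {k : ℤ}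
    (p : relCocycles (sd K) (sdSub K A) k) :
    p = pullbackCocycle (barycentricMap o A) k (sdCocycle p) +
      coboundaryCocycle (sdHomotopy o p.1) (sdHomotopy_mem o p.2.1) := by
  have h : coboundary (sd K) p.1 = 0 := p.2.2
  apply Subtype.ext
  change p.1 = pullback (barycentricMap o A) (sdCochain K p.1) +
    coboundary (sd K) (sdHomotopy o p.1)
  rw [pullback_sdCochain o p.2.1, h, map_zero, add_zero, add_assoc, chain_add_self, add_zero]

theorem pullbackCocycle_add (o : VertexOrder K) {k : ℤ} (p q : relCocycles K A k) :
    pullbackCocycle (barycentricMap o A) k (p + q) =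
      pullbackCocycle (barycentricMap o A) k p + pullbackCocycle (barycentricMap o A) k q :=
  Subtype.ext (pullback_add _ _ _)

theorem sdCocycle_add {k : ℤ} (p q : relCocycles (sd K) (sdSub K A) k) :
    sdCocycle (p + q) = sdCocycle p + sdCocycle q :=
  Subtype.ext (map_add _ _ _)

theorem IsQuadratic.comp_pullback (hM : IsTriangulatedManifold K A n) (o : VertexOrder K)
    {Q' : relCocycles (sd K) (sdSub K A) ((n : ℤ) - 1) → UnitAddCircle}
    (hQ' : IsQuadratic (sdOrder K) (sdSub K A) n Q') :
    IsQuadratic o A n (Q' ∘ pullbackCocycle (barycentricMap o A) ((n : ℤ) - 1)) where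
  add p q := by
    simp only [Function.comp_apply]
    rw [pullbackCocycle_add, hQ'.add]
    congr 2
    exact integral_cup_pullback hM o p.2.1 q.2.1
  coboundary c hc p hp := by
    rw [Function.comp_apply, hQ'.coboundary (pullback (barycentricMap o A) c) (pullback_mem _ hc),
      integral_sq_pullback hM o hc]
    change pullback _ p.1 = _
    rw [hp, pullback_coboundary _ hc]

theorem IsQuadratic.apply_zero {o : VertexOrder K}
    {Q : relCocycles K A ((n : ℤ) - 1) → UnitAddCircle}
    (hQ : IsQuadratic o A n Q) : Q 0 = 0 := by
  have h := hQ.add 0 0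
  rw [add_zero, ZeroMemClass.coe_zero, cup_zero_left, integral_zero, map_zero, add_zero] at h
  exact left_eq_add.1 h

theorem mem_sub_two {k : ℤ} {c : Finset V → ZMod 2} (hc : c ∈ relCochains K A (k - 1 - 1)) :
    c ∈ relCochains K A (k - 2) := by
  rwa [show k - 1 - 1 = k - 2 by ring] at hc

/-- A quadratic function on the subdivision is determined by its values on pulled back
cocycles. -/
theorem IsQuadratic.apply_sd (o : VertexOrder K)
    {Q' : relCocycles (sd K) (sdSub K A) ((n : ℤ) - 1) → UnitAddCircle}
    (hQ' : IsQuadratic (sdOrder K) (sdSub K A) n Q')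
    (p : relCocycles (sd K) (sdSub K A) ((n : ℤ) - 1)) :
    Q' p = Q' (pullbackCocycle (barycentricMap o A) ((n : ℤ) - 1) (sdCocycle p)) +
      ZMod.toAddCircle (integral (sd K) n (sq (sdOrder K) 2 ((n : ℤ) - 2) (sdHomotopy o p.1))) +
      ZMod.toAddCircle (integral (sd K) n (cup (sdOrder K) ((n : ℤ) - 2)
        (pullback (barycentricMap o A) (sdCochain K p.1))
        (QuadraticCocycles.coboundary (sd K) (sdHomotopy o p.1)))) := by
  conv_lhs => rw [eq_pullback_add_coboundary o p]
  rw [hQ'.add, hQ'.coboundary (sdHomotopy o p.1) (mem_sub_two (sdHomotopy_mem o p.2.1))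
    (coboundaryCocycle (sdHomotopy o p.1) (sdHomotopy_mem o p.2.1)) rfl]
  rfl

/-- The extension of a function on the cocycles of `K` to the cocycles of the subdivision. -/
noncomputable def sdExtend (o : VertexOrder K) (A : PreAbstractSimplicialComplex V) (n : ℕ)
    (Q : relCocycles K A ((n : ℤ) - 1) → UnitAddCircle)
    (p : relCocycles (sd K) (sdSub K A) ((n : ℤ) - 1)) : UnitAddCircle :=
  Q (sdCocycle p) +
    ZMod.toAddCircle (integral (sd K) n (sq (sdOrder K) 2 ((n : ℤ) - 2) (sdHomotopy o p.1)) +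
      integral (sd K) n (cup (sdOrder K) ((n : ℤ) - 2)
        (pullback (barycentricMap o A) (sdCochain K p.1))
        (coboundary (sd K) (sdHomotopy o p.1))))

/-- For additivity, expand `p ∪_{n-2} q` with both factors in the form `b^* s + d h`. Its four terms
come from `Q`, from the defect of `∫Sq²`, and twice from the mixed correction, one of these after
commuting the factors. -/
theorem IsQuadratic.sdExtend (hM : IsTriangulatedManifold K A n) (o : VertexOrder K)
    {Q : relCocycles K A ((n : ℤ) - 1) → UnitAddCircle} (hQ : IsQuadratic o A n Q) :
    IsQuadratic (sdOrder K) (sdSub K A) n (sdExtend o A n Q) where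
  add p q := by
    have hK := finite_sd_faces hM.finite
    have hstokes := fun w hw => integral_sd_coboundary (w := w) hM hw
    have h1 := integral_sq_add (sdOrder K) hK hstokes
      (mem_sub_two (sdHomotopy_mem o p.2.1)) (mem_sub_two (sdHomotopy_mem o q.2.1))
    have h2 := integral_cup_comm (sdOrder K) hK hstokes
      (pullbackCocycle (barycentricMap o A) _ (sdCocycle q)).2
      (coboundaryCocycle (sdHomotopy o p.1) (sdHomotopy_mem o p.2.1)).2
    have h3 := integral_cup_pullback hM o (i := (n : ℤ) - 2) (sdCocycle p).2.1 (sdCocycle q).2.1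
    have hp := congrArg Subtype.val (eq_pullback_add_coboundary o p)
    have hq := congrArg Subtype.val (eq_pullback_add_coboundary o q)
    change p.1 = pullback (barycentricMap o A) (sdCochain K p.1) +
      QuadraticCocycles.coboundary (sd K) (sdHomotopy o p.1) at hp
    change q.1 = pullback (barycentricMap o A) (sdCochain K q.1) +
      QuadraticCocycles.coboundary (sd K) (sdHomotopy o q.1) at hq
    have h4 : integral (sd K) n (cup (sdOrder K) ((n : ℤ) - 2) p.1 q.1) =
        integral (sd K) n (cup (sdOrder K) ((n : ℤ) - 2)
          (pullback (barycentricMap o A) (sdCochain K p.1) +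
            QuadraticCocycles.coboundary (sd K) (sdHomotopy o p.1))
          (pullback (barycentricMap o A) (sdCochain K q.1) +
            QuadraticCocycles.coboundary (sd K) (sdHomotopy o q.1))) := by
      rw [← hp, ← hq]
    change integral (sd K) n (cup _ _ (pullback _ (sdCochain K q.1))
      (QuadraticCocycles.coboundary (sd K) (sdHomotopy o p.1))) = integral (sd K) n (cup _ _
      (QuadraticCocycles.coboundary (sd K) (sdHomotopy o p.1))
        (pullback (barycentricMap o A) (sdCochain K q.1))) at h2
    change integral (sd K) n (cup _ _ (pullback _ (sdCochain K p.1))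
      (pullback _ (sdCochain K q.1))) = _ at h3
    simp only [cup_add_left, cup_add_right, integral_add hK] at h4
    rw [h4]
    simp only [QuadraticCocycles.sdExtend, sdCocycle_add, hQ.add, Submodule.coe_add, map_add,
      pullback_add, h1, cup_add_left, cup_add_right, integral_add hK, ← h3, h2]
    abel
  coboundary g hg p hp := by
    have hK := finite_sd_faces hM.finite
    have hstokes := fun w hw => integral_sd_coboundary (w := w) hM hw
    have hs := sdCochain_mem hg
    have hsp : (sdCocycle p).1 = QuadraticCocycles.coboundary K (sdCochain K g) := by
      change sdCochain K p.1 = _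
      rw [hp, coboundary_sdCochain (relCochains_empty hg)]
    have hh : sdHomotopy o p.1 ∈ relCochains (sd K) (sdSub K A) ((n : ℤ) - 2) :=
      mem_sub_two (sdHomotopy_mem o p.2.1)
    have hsp' : pullback (barycentricMap o A) (sdCochain K p.1) =
        QuadraticCocycles.coboundary (sd K) (pullback (barycentricMap o A) (sdCochain K g)) := by
      rw [pullback_coboundary _ hs]
      exact congrArg _ hsp
    -- For `p = dg` the homotopy formula reads `b^* s g + h p = g + d h g`. Applying `∫Sq²` to both
    -- sides gives the three terms of the extension on the left and `∫Sq² g` on the right.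
    have hdecomp : pullback (barycentricMap o A) (sdCochain K g) + sdHomotopy o p.1 =
        g + QuadraticCocycles.coboundary (sd K) (sdHomotopy o g) := by
      rw [pullback_sdCochain o hg, ← hp, add_assoc, chain_add_self, add_zero]
    have hgh := sdHomotopy_mem o hg
    have h1 := integral_sq_add (sdOrder K) hK hstokes
      (pullback_mem (barycentricMap o A) hs) hh
    have h2 := integral_sq_add (sdOrder K) hK hstokes hg
      (by simpa using coboundary_mem hgh :
        QuadraticCocycles.coboundary (sd K) (sdHomotopy o g) ∈ _)
    rw [coboundary_coboundary, cup_zero_right, integral_zero, add_zero,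
      integral_sq_coboundary (sdOrder K) hK hstokes hgh, add_zero, ← hdecomp, h1,
      integral_sq_pullback hM o hs] at h2
    rw [QuadraticCocycles.sdExtend, hQ.coboundary _ hs _ hsp, hsp', ← map_add, ← h2, add_assoc]

/-- For `p' = b^* p` strictness gives `s p' = p`, so `z = h p'` is a cocycle and only `∫Sq² z` must
vanish. Since `z = b^* s z + d h z`, this integral is `∫Sq²(s z)`, and the coboundary axiom for `Q`
on the cocycle `s z` gives `½∫Sq²(s z) = Q(0) = 0`. -/
theorem sdExtend_comp_pullback (hM : IsTriangulatedManifold K A n) (o : VertexOrder K)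
    {Q : relCocycles K A ((n : ℤ) - 1) → UnitAddCircle} (hQ : IsQuadratic o A n Q) :
    sdExtend o A n Q ∘ pullbackCocycle (barycentricMap o A) ((n : ℤ) - 1) = Q := by
  have hK := finite_sd_faces hM.finite
  have hstokes := fun w hw => integral_sd_coboundary (w := w) hM hw
  funext p
  have hsd : sdCocycle (pullbackCocycle (barycentricMap o A) ((n : ℤ) - 1) p) = p :=
    Subtype.ext (sdCochain_pullback o p.2.1)
  have h := eq_pullback_add_coboundary o (pullbackCocycle (barycentricMap o A) ((n : ℤ) - 1) p)
  rw [hsd, left_eq_add] at h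
  set p' := pullbackCocycle (barycentricMap o A) ((n : ℤ) - 1) p
  have hz : coboundary (sd K) (sdHomotopy o p'.1) = 0 := congrArg Subtype.val h
  have hh : sdHomotopy o p'.1 ∈ relCochains (sd K) (sdSub K A) ((n : ℤ) - 2) :=
    mem_sub_two (sdHomotopy_mem o p'.2.1)
  generalize hzdef : sdHomotopy o p'.1 = z at hz hh
  have hsz := sdCochain_mem hh
  have hzz := sdHomotopy_mem o hh
  have hdecomp : z = pullback (barycentricMap o A) (sdCochain K z) +
      coboundary (sd K) (sdHomotopy o z) := by
    rw [pullback_sdCochain o hh, hz, map_zero, add_zero, add_assoc, chain_add_self, add_zero]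
  have h1 := integral_sq_add (sdOrder K) hK hstokes (pullback_mem (barycentricMap o A) hsz)
    (by simpa using coboundary_mem hzz : coboundary (sd K) (sdHomotopy o z) ∈ _)
  rw [coboundary_coboundary, cup_zero_right, integral_zero, add_zero,
    integral_sq_coboundary (sdOrder K) hK hstokes hzz, add_zero, ← hdecomp,
    integral_sq_pullback hM o hsz] at h1
  have h2 := hQ.coboundary (sdCochain K z) hsz 0 (by
    rw [coboundary_sdCochain (relCochains_empty hh), hz, map_zero]
    rfl)
  rw [hQ.apply_zero] at h2
  rw [Function.comp_apply, sdExtend, hsd, hzdef, hz, cup_zero_right, integral_zero, add_zero, h1,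
    ← h2, add_zero]

/-- Quadratic functions on the subdivision restrict bijectively to quadratic functions. -/
theorem bijOn_comp_pullback (hM : IsTriangulatedManifold K A n) (o : VertexOrder K) :
    Set.BijOn
      (fun Q' : relCocycles (sd K) (sdSub K A) ((n : ℤ) - 1) → UnitAddCircle =>
        Q' ∘ pullbackCocycle (barycentricMap o A) ((n : ℤ) - 1))
      {Q' | IsQuadratic (sdOrder K) (sdSub K A) n Q'} {Q | IsQuadratic o A n Q} := by
  refine ⟨fun Q' hQ' => IsQuadratic.comp_pullback hM o hQ', fun Q₁ h₁ Q₂ h₂ h => ?_,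
    fun Q hQ => ⟨sdExtend o A n Q, IsQuadratic.sdExtend hM o hQ, sdExtend_comp_pullback hM o hQ⟩⟩
  funext p
  have hp := congrFun h (sdCocycle p)
  simp only [Function.comp_apply] at hp
  rw [IsQuadratic.apply_sd o h₁, IsQuadratic.apply_sd o h₂, hp]

end Main

end QuadraticCocycles

theorem mainTheorem5 {V : Type*} (K A : PreAbstractSimplicialComplex V) (n : ℕ)
    (hM : QuadraticCocycles.IsTriangulatedManifold K A n) :
    (∀ o : QuadraticCocycles.VertexOrder K,
      Set.BijOn
        (fun Q' : QuadraticCocycles.relCocycles (QuadraticCocycles.sd K)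
            (QuadraticCocycles.sdSub K A) ((n : ℤ) - 1) → UnitAddCircle =>
          Q' ∘ QuadraticCocycles.pullbackCocycle
            (QuadraticCocycles.barycentricMap o A) ((n : ℤ) - 1))
        {Q' | QuadraticCocycles.IsQuadratic (QuadraticCocycles.sdOrder K)
          (QuadraticCocycles.sdSub K A) n Q'}
        {Q | QuadraticCocycles.IsQuadratic o A n Q}) ∧
    (∀ o₁ o₂ : QuadraticCocycles.VertexOrder K,
      ∃! Φ : {Q // QuadraticCocycles.IsQuadratic o₁ A n Q} ≃
          {Q // QuadraticCocycles.IsQuadratic o₂ A n Q},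
        ∀ Q' : QuadraticCocycles.relCocycles (QuadraticCocycles.sd K)
            (QuadraticCocycles.sdSub K A) ((n : ℤ) - 1) → UnitAddCircle,
          QuadraticCocycles.IsQuadratic (QuadraticCocycles.sdOrder K)
            (QuadraticCocycles.sdSub K A) n Q' →
          ∀ Q₁ : {Q // QuadraticCocycles.IsQuadratic o₁ A n Q},
            Q₁.1 = Q' ∘ QuadraticCocycles.pullbackCocycle
              (QuadraticCocycles.barycentricMap o₁ A) ((n : ℤ) - 1) →
            (Φ Q₁).1 = Q' ∘ QuadraticCocycles.pullbackCocycle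
              (QuadraticCocycles.barycentricMap o₂ A) ((n : ℤ) - 1)) := by
  have hbij := QuadraticCocycles.bijOn_comp_pullback hM
  refine ⟨hbij, fun o₁ o₂ => ?_⟩
  let e₁ := Set.BijOn.equiv _ (hbij o₁)
  let e₂ := Set.BijOn.equiv _ (hbij o₂)
  -- Uniqueness uses surjectivity of `e₁`: the condition prescribes `Φ` on every restriction of a
  -- quadratic function on the subdivision, hence everywhere.
  refine ⟨e₁.symm.trans e₂, fun Q' hQ' Q₁ h => ?_, fun Φ hΦ => Equiv.ext fun Q₁ => ?_⟩
  · have h' : e₁ ⟨Q', hQ'⟩ = Q₁ := Subtype.ext h.symm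
    change (e₂ (e₁.symm Q₁)).1 = _
    rw [← h', Equiv.symm_apply_apply]
    rfl
  · obtain ⟨Q', rfl⟩ := e₁.surjective Q₁
    refine Subtype.ext ((hΦ Q'.1 Q'.2 _ rfl).trans ?_)
    change _ = (e₂ (e₁.symm (e₁ Q'))).1
    rw [Equiv.symm_apply_apply]
    rfl
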